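/- **Setting.** Fix $r\ge 1$ and a set $E\subseteq\{0,\dots,r-1\}^2$ of directed edges such that the transition graph $(\{0,\dots,r-1\},E)$ is irreducible and aperiodic, and $d:=|E|-r>0$. Each transition matrix that is positive exactly on $E$ is described by $d$ free transition probabilities (in each row one edge of $E$ is omitted, its probability being one minus the sum of the others). There are users $1,2,\dots$; their parameter vectors $\mathbf p_1,\mathbf p_2,\dots\in(0,1)^d$ are independent and identically distributed, with a bounded density $f_{\mathbf P}$ that vanishes outside the set of vectors of positive free transition probabilities whose sum in each row is less than $1$. $X_u(k)\in\{0,\dots,r-1\}$ is the data sample of user $u$ at time $k$. Conditionally on $(\mathbf p_u)_u$: * the data of each user $u$ is a Markov chain with the transition matrix given by $\mathbf p_u$ (and any initial distribution); * the users are the vertices of an association graph $G$, in which distinct users $u,u'$ are adjacent if and only if $I(X_u(k);X_{u'}(k))$ is bounded away from $0$ for large $k$ (for stationary data: $I(X_u(k);X_{u'}(k))>0$). The groups are the connected components of $G$; * users of different groups have independent data, and the joint data of each group is a time-homogeneous Markov chain that is irreducible and aperiodic on the set of joint states that occur with positive probability. The dependence inside the groups is otherwise arbitrary. Every group is finite,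 and for every $\varepsilon>0$ the number of users among $1,\dots,n$ that belong to one group is $O(n^\varepsilon)$ uniformly in the group (for example, the group sizes are bounded). The group of user $1$ has size $s\ge 1$. In the system of the users $1,\dots,n$, the data is anonymized by a random permutation $\Pi$ of $\{1,\dots,n\}$: the adversary observes $Y_{j}(k)=X_{\Pi^{-1}(j)}(k)$ for $1\le j\le n$ and $1\le k\le m$, where $m=m(n)$ is $cn^{\frac{2}{s(|E|-r)}+\alpha}$ rounded to an integer, with constants $c>0$ and $\alpha>0$. The adversary knows $\mathbf p_1,\dots,\mathbf p_n$ and the association graph on $\{1,\dots,n\}$, but neither $\Pi$ nor the joint distribution of the data of dependent users. **Theorem.** User $1$ has no privacy as $n\to\infty$: there is an estimator $\widetilde{X_1(k)}$, a measurable function of $\mathbf p_1,\dots,\mathbf p_n$, the association graph on $\{1,\dots,n\}$ and the observations $Y$, which depends on $E,s,c,\alpha$ and the rounding of $m$, but not on $f_{\mathbf P}$, nor on the distribution of $\Pi$, nor on the joint distribution of the data, such that for every $k\in\mathbb N$ $$P\bigl(\widetilde{X_1(k)}\neq X_1(k)\bigr)\longrightarrow 0\qquad(n\to\infty).$$ 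-/

import Mathlib

open MeasureTheory ProbabilityTheory Filter Topology
open scoped ENNReal NNReal

noncomputable section

/-! ### Finite directed graphs and Markov chains -/

/-- `StepsTo R k x y`: the directed graph `R` has a walk of length `k` from `x` to `y`. -/
def StepsTo {S : Type*} (R : S → S → Prop) : ℕ → S → S → Prop
  | 0, x, y => x = y
  | k + 1, x, y => ∃ z, R x z ∧ StepsTo R k z y

/-- Irreducibility on the set `A` of states. -/
def IrreducibleOn {S : Type*} (R : S → S → Prop) (A : Set S) : Prop :=
  ∀ x ∈ A, ∀ y ∈ A, ∃ k, StepsTo R k x y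

/-- Aperiodicity on the set `A` of states: for each state in `A`, the greatest common divisor of
the lengths of the closed walks of positive length through it is `1`. -/
def AperiodicOn {S : Type*} (R : S → S → Prop) (A : Set S) : Prop :=
  ∀ x ∈ A, ∀ d : ℕ, (∀ k, 0 < k → StepsTo R k x x → d ∣ k) → d = 1

/-- `ρ` is the law of a time-homogeneous Markov chain with transition probabilities `T`
(and an arbitrary initial distribution), for a countable state space `S`. -/
def IsMarkovChainLaw {S : Type*} [MeasurableSpace S] (ρ : Measure (ℕ → S)) (T : S → S → ℝ) :
    Prop :=
  ∀ (k : ℕ) (x : ℕ → S),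
    ρ {ω | ∀ i ≤ k + 1, ω i = x i}
      = ρ {ω | ∀ i ≤ k, ω i = x i} * ENNReal.ofReal (T (x k) (x (k + 1)))

/-- The states that a process with law `ρ` visits with positive probability. -/
def visitedStates {S : Type*} [MeasurableSpace S] (ρ : Measure (ℕ → S)) : Set S :=
  {z | ∃ k, ρ {ω | ω k = z} ≠ 0}

/-- The mutual information `I(A; B)` (in nats) of two random variables with values in a
finite set. -/
def mutualInformation {Ω S : Type*} [MeasurableSpace Ω] [Fintype S] (μ : Measure Ω)
    (A B : Ω → S) : ℝ :=
  ∑ a, ∑ b, μ.real {ω | A ω = a ∧ B ω = b} *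
    Real.log (μ.real {ω | A ω = a ∧ B ω = b} / (μ.real {ω | A ω = a} * μ.real {ω | B ω = b}))

/-! ### Transition matrices with a prescribed transition graph -/

/-- The edges whose probabilities serve as coordinates: in the row of each state `i`, the edge
`(i, o i)` is left out, because its probability is determined by the others. -/
abbrev FreeEdge {r : ℕ} (E : Finset (Fin r × Fin r)) (o : Fin r → Fin r) : Type :=
  {e : Fin r × Fin r // e ∈ E ∧ e.2 ≠ o e.1}

/-- Vectors of free transition probabilities, the coordinate space `ℝ ^ (|E| - r)`. -/
abbrev Param {r : ℕ} (E : Finset (Fin r × Fin r)) (o : Fin r → Fin r) : Type :=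
  FreeEdge E o → ℝ

/-- The sum of the free transition probabilities out of the state `i`. -/
def rowSum {r : ℕ} {E : Finset (Fin r × Fin r)} {o : Fin r → Fin r} (x : Param E o)
    (i : Fin r) : ℝ :=
  ∑ e : FreeEdge E o, if e.1.1 = i then x e else 0

/-- The transition matrix with the free transition probabilities `x`. -/
def transitionMatrix {r : ℕ} {E : Finset (Fin r × Fin r)} {o : Fin r → Fin r} (x : Param E o)
    (i l : Fin r) : ℝ :=
  if h : (i, l) ∈ E ∧ l ≠ o i then x ⟨(i, l), h⟩
  else if l = o i then 1 - rowSum x i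
  else 0

/-- The parameters for which every edge of `E` has positive transition probability. -/
def paramRegion {r : ℕ} (E : Finset (Fin r × Fin r)) (o : Fin r → Fin r) : Set (Param E o) :=
  {x | (∀ e, 0 < x e) ∧ ∀ i, rowSum x i < 1}

/-- `f` is a bounded probability density on the set of admissible parameters. -/
structure IsParamDensity {r : ℕ} {E : Finset (Fin r × Fin r)} {o : Fin r → Fin r}
    (f : Param E o → ℝ≥0∞) : Prop where
  measurable : Measurable f
  lintegral_eq_one : ∫⁻ x, f x = 1
  eq_zero : ∀ x, x ∉ paramRegion E o → f x = 0
  bounded : ∃ δ : ℝ≥0, ∀ x, f x ≤ δ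

/-- The law of the parameters of all users `0, 1, 2, …`: independent, each with density `f`. -/
def populationLaw {r : ℕ} {E : Finset (Fin r × Fin r)} {o : Fin r → Fin r}
    (f : Param E o → ℝ≥0∞) : Measure (ℕ → Param E o) :=
  Measure.infinitePi fun _ => volume.withDensity f

/-! ### The data of the users -/

/-- The data of all users: `x u k` is the sample of user `u` at time `k`. -/
abbrev Traces (r : ℕ) : Type := ℕ → ℕ → Fin r

/-- The trace of the group `C`, as a sequence of joint states. -/
def groupTrace {r : ℕ} (C : Set ℕ) (x : Traces r) : ℕ → (C → Fin r) :=
  fun k u => x u k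

/-- The properties of the conditional law `ρ` of all the data, given that the users' transition
matrices are those with parameters `p`, when `G` is the association graph, whose connected
components are the groups. -/
structure IsDataLaw {r : ℕ} {E : Finset (Fin r × Fin r)} {o : Fin r → Fin r}
    (G : SimpleGraph ℕ) (p : ℕ → Param E o) (ρ : Measure (Traces r)) : Prop where
  /-- Each user's data is a Markov chain with the transition matrix of that user. -/
  user_markov : ∀ u, IsMarkovChainLaw (ρ.map fun x => x u) (transitionMatrix (p u))
  /-- The joint data of each group is an irreducible, aperiodic Markov chain on the set of joint
  states that occur. -/
  group_markov : ∀ C : G.ConnectedComponent, ∃ T : (C.supp → Fin r) → (C.supp → Fin r) → ℝ,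
    IsMarkovChainLaw (ρ.map (groupTrace C.supp)) T ∧
    IrreducibleOn (fun y z => 0 < T y z) (visitedStates (ρ.map (groupTrace C.supp))) ∧
    AperiodicOn (fun y z => 0 < T y z) (visitedStates (ρ.map (groupTrace C.supp)))
  /-- Two users are adjacent iff their simultaneous samples have positive mutual information in
  the steady state. If the data is stationary, the mutual information does not depend on `k`, and
  this says that it is positive. -/
  association : ∀ u v, u ≠ v → (G.Adj u v ↔
    ∃ η : ℝ, 0 < η ∧ ∀ᶠ k in atTop,
      η ≤ mutualInformation ρ (fun x : Traces r => x u k) (fun x : Traces r => x v k))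
  /-- Users of different groups have independent data. -/
  indep : ∀ u v, ¬ G.Reachable u v →
    IndepFun (fun x : Traces r => x u) (fun x : Traces r => x v) ρ

/-- Each group is finite, and the number of the first `n` users that belong to a single group is
`O(n ^ ε)` for every `ε > 0`, uniformly in the group. -/
def HasSmallGroups (G : SimpleGraph ℕ) : Prop :=
  (∀ C : G.ConnectedComponent, C.supp.Finite) ∧
  ∀ ε : ℝ, 0 < ε → ∃ B : ℝ, ∀ (n : ℕ) (C : G.ConnectedComponent),
    ((C.supp ∩ Set.Iio n).ncard : ℝ) ≤ B * (n : ℝ) ^ ε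

/-- The association graph of the first `n` users. -/
def firstUsers (G : SimpleGraph ℕ) (n : ℕ) : SimpleGraph (Fin n) :=
  G.comap Fin.val

/-! ### Anonymization and the adversary -/

/-- The observations `Y`: the first `m` samples of each of the first `n` users, with user `u`
renamed to `π u`, so that the trace with pseudonym `j` is the one of the user `π⁻¹ j`. -/
def anonymize {r n : ℕ} (m : ℕ) (π : Equiv.Perm (Fin n)) (x : Traces r) :
    Fin n → Fin m → Fin r :=
  fun j k => x (π.symm j) k

/-- An adversary's estimator of the sample of user `0` at each time. For a system of `n` users, it
is computed from the association graph of the users, the transition probabilities of the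
users, and the `m n` anonymized observations per user. -/
abbrev Estimator {r : ℕ} (E : Finset (Fin r × Fin r)) (o : Fin r → Fin r) (m : ℕ → ℕ) : Type :=
  (n : ℕ) → SimpleGraph (Fin n) → (Fin n → Param E o) → (Fin n → Fin (m n) → Fin r) →
    (k : ℕ) → Fin r

/-- The estimator is a measurable function of the parameters and the observations. -/
def Estimator.IsMeasurable {r : ℕ} {E : Finset (Fin r × Fin r)} {o : Fin r → Fin r} {m : ℕ → ℕ}
    (A : Estimator E o m) : Prop :=
  ∀ (n : ℕ) (H : SimpleGraph (Fin n)) (k : ℕ),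
    Measurable fun z : (Fin n → Param E o) × (Fin n → Fin (m n) → Fin r) => A n H z.1 z.2 k

/-- The event that, with `n` users, the estimate of the sample of user `0` at time `k` is wrong. -/
def errorEvent {r : ℕ} {E : Finset (Fin r × Fin r)} {o : Fin r → Fin r} {m : ℕ → ℕ}
    (A : Estimator E o m) (G : SimpleGraph ℕ) {Ω : Type*} (P : Ω → ℕ → Param E o)
    (X : Ω → Traces r) (perm : (n : ℕ) → Ω → Equiv.Perm (Fin n)) (n k : ℕ) : Set Ω :=
  {ω | A n (firstUsers G n) (fun u => P ω u) (anonymize (m n) (perm n ω) (X ω)) k ≠ X ω 0 k}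

end

/-! Put d = |E| - r, M = m - 1 and β = α/8. A trace of length m determines transition probabilities
up to about m^(-1/2), so s traces confine the s·d parameters of a group to a box of volume about
m^(-sd/2). At most n other groups compete with the group of user `0`, and m ≫ n^(2/(sd)) makes it
unlikely that one of them meets this box. It remains to prevent s traces from different groups from
being pieced together; this is what the association graph is for.

The estimator takes any assignment of pseudonyms satisfying `Passes`: jump counts match each user's
matrix up to l = n^β √M, every state has more than b = n^(-β) M visits, and for adjacent users the
pair frequencies miss invariance under the product of the two transition matrices by at least b. The
last test requires no knowledge of joint laws.

The truth passes with probability tending to 1. An exponential martingale bound that is uniform over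
all chains (`measure_jumps_deviation_le`) makes all users, and all pairs from different groups,
conform at once. The ergodic theorem, whose speed depends on the parameters, is needed only for the
fixed finite group of user `0`. For associated users, invariant limiting pair frequencies would be
the product law by uniqueness, and the mutual information would vanish
(`IsDataLaw.exists_tendsto_defect`).

Conversely, let a permutation τ pass. One trace conforming to two matrices forces them to be within
2l/b (`Passes.param_close`). Images of adjacent users lie in one group, because independent pairs
fail the dependence test, so by connectivity the whole image lies in one group (`Passes.reachable`).
If τ moves user `0`, then either two users of its group nearly coincide or the group nearly
coincides with s users of another group. Both are improbable under a bounded density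
(`populationLaw_collisions_le`). -/

/-! ### Walks in finite directed graphs -/

section Walks

variable {S : Type*} {R R' : S → S → Prop}

theorem StepsTo.trans {k l : ℕ} {x y z : S} (h : StepsTo R k x y) (h' : StepsTo R l y z) :
    StepsTo R (k + l) x z := by
  induction k generalizing x with
  | zero => cases h; simpa using h'
  | succ k ih =>
    obtain ⟨w, hw, hwy⟩ := h
    rw [Nat.add_right_comm]
    exact ⟨w, hw, ih hwy⟩

theorem StepsTo.congr_on {A : Set S} (hA : ∀ x ∈ A, ∀ y, R x y → R' x y ∧ y ∈ A) {k : ℕ} {x y : S}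
    (hx : x ∈ A) (h : StepsTo R k x y) : StepsTo R' k x y := by
  induction k generalizing x with
  | zero => exact h
  | succ k ih =>
    obtain ⟨w, hw, hwy⟩ := h
    exact ⟨w, (hA x hx w hw).1, ih (hA x hx w hw).2 hwy⟩

/-- Concatenation makes the lengths of closed walks at `x` an additive submonoid of ℕ. Aperiodicity
says that its gcd is 1, and such a submonoid contains all large numbers. -/
theorem exists_forall_stepsTo_self {A : Set S} (hap : AperiodicOn R A) {x : S} (hx : x ∈ A) :
    ∃ N, ∀ n ≥ N, StepsTo R n x x := by
  let L : AddSubmonoid ℕ :=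
    { carrier := {k | StepsTo R k x x}
      zero_mem' := rfl
      add_mem' := fun h h' => h.trans h' }
  have hg : Nat.setGcd (L : Set ℕ) = 1 :=
    hap x hx _ fun k _ hk => Nat.setGcd_dvd_of_mem hk
  obtain ⟨N, hN⟩ := Nat.exists_mem_closure_of_ge (L : Set ℕ)
  refine ⟨N, fun n hn => ?_⟩
  have h := hN n hn (by rw [hg]; exact one_dvd _)
  rw [AddSubmonoid.closure_eq] at h
  exact h

/-- In a finite irreducible and aperiodic graph, all long lengths are lengths of walks between any
two states. -/
theorem exists_forall_stepsTo [Finite S] {A : Set S} (hirr : IrreducibleOn R A)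
    (hap : AperiodicOn R A) : ∃ N, ∀ n ≥ N, ∀ x ∈ A, ∀ y ∈ A, StepsTo R n x y := by
  classical
  have := Fintype.ofFinite S
  have h : ∀ q : S × S, ∃ N, q.1 ∈ A → q.2 ∈ A → ∀ n ≥ N, StepsTo R n q.1 q.2 := by
    rintro ⟨x, y⟩
    by_cases hx : x ∈ A
    · by_cases hy : y ∈ A
      · obtain ⟨N, hN⟩ := exists_forall_stepsTo_self hap hx
        obtain ⟨k, hk⟩ := hirr x hx y hy
        refine ⟨N + k, fun _ _ n hn => ?_⟩
        have := (hN (n - k) (by omega)).trans hk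
        rwa [Nat.sub_add_cancel (by omega)] at this
      · exact ⟨0, fun _ h => absurd h hy⟩
    · exact ⟨0, fun h => absurd h hx⟩
  choose N hN using h
  refine ⟨Finset.univ.sup N, fun n hn x hx y hy => hN (x, y) hx hy n ?_⟩
  exact (Finset.le_sup (f := N) (Finset.mem_univ (x, y))).trans hn

end Walks

/-! ### Stochastic matrices -/

section Stochastic

open Matrix

variable {S : Type*} [Fintype S]

/-- The `ℓ¹` norm of a vector. -/
def lOne (x : S → ℝ) : ℝ := ∑ i, |x i|

theorem lOne_nonneg (x : S → ℝ) : 0 ≤ lOne x := Finset.sum_nonneg fun _ _ => abs_nonneg _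

theorem abs_le_lOne (x : S → ℝ) (i : S) : |x i| ≤ lOne x :=
  Finset.single_le_sum (f := fun i => |x i|) (fun _ _ => abs_nonneg _) (Finset.mem_univ i)

theorem lOne_sub_comm (x y : S → ℝ) : lOne (x - y) = lOne (y - x) := by
  simp [lOne, abs_sub_comm]

theorem lOne_add_le (x y : S → ℝ) : lOne (x + y) ≤ lOne x + lOne y := by
  rw [lOne, lOne, lOne, ← Finset.sum_add_distrib]
  exact Finset.sum_le_sum fun _ _ => abs_add_le _ _

theorem lOne_eq_zero {x : S → ℝ} (h : lOne x ≤ 0) : x = 0 :=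
  funext fun i => abs_nonpos_iff.1 ((abs_le_lOne x i).trans h)

variable [DecidableEq S] {T : Matrix S S ℝ}

theorem pow_apply_pos_of_stepsTo (hT : ∀ x y, 0 ≤ T x y) {k : ℕ} {x y : S}
    (h : StepsTo (fun a b => 0 < T a b) k x y) : 0 < (T ^ k) x y := by
  have hnn : ∀ k x y, 0 ≤ (T ^ k) x y := fun k => by
    induction k with
    | zero => intro x y; simp only [pow_zero, one_apply]; split_ifs <;> norm_num
    | succ k ih =>
      intro x y
      rw [pow_succ', mul_apply]
      exact Finset.sum_nonneg fun z _ => mul_nonneg (hT _ _) (ih _ _)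
  induction k generalizing x with
  | zero => cases h; simp
  | succ k ih =>
    obtain ⟨w, hw, hwy⟩ := h
    rw [pow_succ', mul_apply]
    exact Finset.sum_pos' (fun z _ => mul_nonneg (hT _ _) (hnn _ _ _))
      ⟨w, Finset.mem_univ _, mul_pos hw (ih hwy)⟩

theorem sum_vecMul_of_rowStochastic (hT : T ∈ rowStochastic ℝ S) (x : S → ℝ) :
    ∑ z, (x ᵥ* T) z = ∑ z, x z := by
  simp only [vecMul, dotProduct]
  rw [Finset.sum_comm]
  simp [← Finset.mul_sum, sum_row_of_mem_rowStochastic hT]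

theorem lOne_vecMul_le (hT : T ∈ rowStochastic ℝ S) (x : S → ℝ) : lOne (x ᵥ* T) ≤ lOne x := by
  calc lOne (x ᵥ* T) ≤ ∑ z, ∑ y, |x y| * T y z := by
        refine Finset.sum_le_sum fun z _ => (Finset.abs_sum_le_sum_abs _ _).trans_eq ?_
        exact Finset.sum_congr rfl fun y _ => by
          rw [abs_mul, abs_of_nonneg (nonneg_of_mem_rowStochastic hT)]
    _ = lOne x := by
        rw [Finset.sum_comm]
        simp [← Finset.mul_sum, sum_row_of_mem_rowStochastic hT, lOne]

/-- Doeblin's contraction. -/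
theorem lOne_vecMul_le_of_column (hT : T ∈ rowStochastic ℝ S) {θ : ℝ} {z₀ : S}
    (hθ : ∀ y, θ ≤ T y z₀) {x : S → ℝ} (hx : ∑ z, x z = 0) :
    lOne (x ᵥ* T) ≤ (1 - θ) * lOne x := by
  -- As `x` has sum 0, subtracting θ from the column `z₀` does not change the product; what remains
  -- is nonnegative with row sums 1 - θ.
  have h1 : ∀ z, (x ᵥ* T) z = ∑ y, x y * (T y z - if z = z₀ then θ else 0) := fun z => by
    simp only [vecMul, dotProduct, mul_sub, Finset.sum_sub_distrib, ← Finset.sum_mul, hx, zero_mul,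
      sub_zero]
  have h0 : ∀ y z, 0 ≤ T y z - if z = z₀ then θ else 0 := fun y z => by
    split_ifs with h
    · rw [h]; exact sub_nonneg.2 (hθ y)
    · simpa using nonneg_of_mem_rowStochastic hT
  calc lOne (x ᵥ* T) ≤ ∑ z, ∑ y, |x y| * (T y z - if z = z₀ then θ else 0) := by
        refine Finset.sum_le_sum fun z _ => ?_
        rw [h1]
        refine (Finset.abs_sum_le_sum_abs _ _).trans_eq ?_
        exact Finset.sum_congr rfl fun y _ => by rw [abs_mul, abs_of_nonneg (h0 y z)]
    _ = (1 - θ) * lOne x := by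
        rw [Finset.sum_comm]
        simp [← Finset.mul_sum, Finset.sum_sub_distrib, sum_row_of_mem_rowStochastic hT, lOne,
          ← Finset.sum_mul, mul_comm]

/-- Telescoping: a stochastic matrix does not increase the norm, so no later step moves farther than
the first. -/
theorem lOne_vecMul_pow_sub_le (hT : T ∈ rowStochastic ℝ S) (x : S → ℝ) (N : ℕ) :
    lOne (x ᵥ* T ^ N - x) ≤ N * lOne (x ᵥ* T - x) := by
  induction N with
  | zero => simp [lOne]
  | succ N ih =>
    have h : x ᵥ* T ^ (N + 1) - x = (x ᵥ* T - x) ᵥ* T ^ N + (x ᵥ* T ^ N - x) := by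
      rw [sub_vecMul, vecMul_vecMul, ← pow_succ']; abel
    rw [h]
    have h2 := lOne_vecMul_le (pow_mem hT N) (x ᵥ* T - x)
    have h3 := lOne_add_le ((x ᵥ* T - x) ᵥ* T ^ N) (x ᵥ* T ^ N - x)
    push_cast
    linarith

/-- A stochastic matrix, some power of which has a positive column. -/
def IsDoeblin (T : Matrix S S ℝ) : Prop :=
  T ∈ rowStochastic ℝ S ∧ ∃ (N : ℕ) (z₀ : S), ∀ y, 0 < (T ^ N) y z₀

theorem IsDoeblin.exists_column (h : IsDoeblin T) :
    ∃ (N : ℕ) (z₀ : S) (θ : ℝ), 0 < θ ∧ ∀ y, θ ≤ (T ^ N) y z₀ := by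
  obtain ⟨-, N, z₀, h⟩ := h
  have : Nonempty S := ⟨z₀⟩
  obtain ⟨y₀, hy₀⟩ := Finite.exists_min fun y => (T ^ N) y z₀
  exact ⟨N, z₀, _, h y₀, hy₀⟩

/-- Vectors of sum `0` that are nearly invariant are small. -/
theorem IsDoeblin.exists_lOne_le (h : IsDoeblin T) :
    ∃ K : ℝ, 0 < K ∧ ∀ x : S → ℝ, ∑ z, x z = 0 → lOne x ≤ K * lOne (x ᵥ* T - x) := by
  obtain ⟨N, z₀, θ, hθ, hc⟩ := h.exists_column
  -- The estimates below give θ · lOne x ≤ N · lOne (x ᵥ* T - x); `N + 1` keeps the constant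
  -- positive when `N = 0`.
  refine ⟨(N + 1) / θ, by positivity, fun x hx => ?_⟩
  have h1 := lOne_vecMul_le_of_column (pow_mem h.1 N) hc hx
  have h2 := lOne_vecMul_pow_sub_le h.1 x N
  have h3 : lOne x ≤ lOne (x ᵥ* T ^ N) + lOne (x ᵥ* T ^ N - x) := by
    have := lOne_add_le (x ᵥ* T ^ N) (x - x ᵥ* T ^ N)
    rw [add_sub_cancel, lOne_sub_comm x] at this
    exact this
  have h4 := lOne_nonneg (x ᵥ* T - x)
  rw [div_mul_eq_mul_div, le_div_iff₀ hθ]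
  nlinarith

theorem IsDoeblin.eq_of_invariant (h : IsDoeblin T) {x y : S → ℝ} (hx : x ᵥ* T = x)
    (hy : y ᵥ* T = y) (hxy : ∑ z, x z = ∑ z, y z) : x = y := by
  obtain ⟨K, -, hK⟩ := h.exists_lOne_le
  have := hK (x - y) (by simp [hxy])
  rw [sub_vecMul, hx, hy, sub_self] at this
  exact sub_eq_zero.1 (lOne_eq_zero (by simpa [lOne] using this))

/-- `T - 1` annihilates the constant vector, so it is singular and has a left null vector, whose sum
is nonzero because the contraction excludes nonzero invariant vectors of sum 0. -/
theorem IsDoeblin.exists_invariant (h : IsDoeblin T) :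
    ∃ x : S → ℝ, x ᵥ* T = x ∧ ∑ z, x z = 1 := by
  obtain ⟨N, z₀, θ, hθ, hc⟩ := h.exists_column
  have hdet : (T - 1).det = 0 := by
    rw [← exists_mulVec_eq_zero_iff]
    refine ⟨1, fun h => one_ne_zero (congrFun h z₀), ?_⟩
    rw [sub_mulVec, one_mulVec, (mem_rowStochastic.1 h.1).2, sub_self]
  obtain ⟨v, hv, hv0⟩ := exists_vecMul_eq_zero_iff.2 hdet
  rw [vecMul_sub, vecMul_one, sub_eq_zero] at hv0
  have hs : ∑ z, v z ≠ 0 := fun hs =>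
    hv (h.eq_of_invariant hv0 (by simp) (by simpa using hs))
  refine ⟨(∑ z, v z)⁻¹ • v, by rw [smul_vecMul, hv0], ?_⟩
  simp [← Finset.mul_sum, hs]

/-- The norms decrease to a limit L, and comparing the times k + N and k yields L ≤ (1 - θ) L. -/
theorem IsDoeblin.tendsto_vecMul_pow (h : IsDoeblin T) {x : S → ℝ} (hx : ∑ z, x z = 0) :
    Tendsto (fun k => lOne (x ᵥ* T ^ k)) atTop (𝓝 0) := by
  obtain ⟨N, z₀, θ, hθ, hc⟩ := h.exists_column
  have hanti : Antitone fun k => lOne (x ᵥ* T ^ k) := antitone_nat_of_succ_le fun k => by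
    rw [pow_succ, ← vecMul_vecMul]
    exact lOne_vecMul_le h.1 _
  have hlim := tendsto_atTop_ciInf hanti ⟨0, by rintro _ ⟨k, rfl⟩; exact lOne_nonneg _⟩
  set L := ⨅ k, lOne (x ᵥ* T ^ k)
  have hL0 : 0 ≤ L := ge_of_tendsto' hlim fun _ => lOne_nonneg _
  have hL : L ≤ (1 - θ) * L := by
    refine le_of_tendsto_of_tendsto' ((tendsto_add_atTop_iff_nat N).2 hlim)
      (hlim.const_mul (1 - θ)) fun k => ?_
    rw [pow_add, ← vecMul_vecMul]
    refine lOne_vecMul_le_of_column (pow_mem h.1 N) hc ?_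
    rw [sum_vecMul_of_rowStochastic (pow_mem h.1 k), hx]
  have : L = 0 := by nlinarith
  rwa [this] at hlim

/-- The transition matrix of two independent Markov chains. -/
def prodMatrix (T T' : Matrix S S ℝ) : Matrix (S × S) (S × S) ℝ :=
  fun y z => T y.1 z.1 * T' y.2 z.2

theorem prodMatrix_pow (T T' : Matrix S S ℝ) (k : ℕ) :
    prodMatrix T T' ^ k = prodMatrix (T ^ k) (T' ^ k) := by
  induction k with
  | zero => ext y z; simp [prodMatrix, one_apply, Prod.ext_iff, ← ite_and, and_comm]
  | succ k ih =>
    rw [pow_succ, ih]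
    ext y z
    simp only [mul_apply, prodMatrix, pow_succ, Fintype.sum_prod_type, Finset.sum_mul_sum]
    exact Finset.sum_congr rfl fun _ _ => Finset.sum_congr rfl fun _ _ => by ring

theorem prodMatrix_mem_rowStochastic {T T' : Matrix S S ℝ} (hT : T ∈ rowStochastic ℝ S)
    (hT' : T' ∈ rowStochastic ℝ S) : prodMatrix T T' ∈ rowStochastic ℝ (S × S) := by
  rw [mem_rowStochastic_iff_sum] at *
  refine ⟨fun y z => mul_nonneg (hT.1 _ _) (hT'.1 _ _), fun y => ?_⟩
  simp [prodMatrix, Fintype.sum_prod_type, ← Finset.mul_sum, hT.2, hT'.2]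

end Stochastic

/-! ### Laws of finite Markov chains -/

section MarkovLaw

open Matrix

variable {S : Type*} [Fintype S] [MeasurableSpace S] [MeasurableSingletonClass S]
  {ρ : Measure (ℕ → S)} {T : S → S → ℝ}

/-- The path that extends a finite path by repeating its last state. -/
def extendPath {k : ℕ} (w : Fin (k + 1) → S) : ℕ → S :=
  fun i => w ⟨min i k, by omega⟩

omit [Fintype S] in
theorem measurableSet_cylinder_le (k : ℕ) (x : ℕ → S) : MeasurableSet {ω : ℕ → S | ∀ i ≤ k, ω i = x i} := by
  have : {ω : ℕ → S | ∀ i ≤ k, ω i = x i} = ⋂ i, ⋂ (_ : i ≤ k), (fun ω => ω i) ⁻¹' {x i} := by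
    ext; simp
  rw [this]
  exact MeasurableSet.iInter fun i => MeasurableSet.iInter fun _ =>
    measurable_pi_apply i (measurableSet_singleton _)

/-- The Markov property, integrated against a functional `F` of the past. Both sides split into
finitely many cylinders, to each of which the definition applies. -/
theorem lintegral_markov_step (hρ : IsMarkovChainLaw ρ T) (k : ℕ) {F : (ℕ → S) → ℝ≥0∞}
    (hF : ∀ ω ω', (∀ i ≤ k, ω i = ω' i) → F ω = F ω') (g : S → S → ℝ≥0∞) :
    ∫⁻ ω, F ω * g (ω k) (ω (k + 1)) ∂ρ
      = ∫⁻ ω, F ω * ∑ z, ENNReal.ofReal (T (ω k) z) * g (ω k) z ∂ρ := by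
  classical
  let upd : (Fin (k + 1) → S) → S → ℕ → S := fun w z i => if i ≤ k then extendPath w i else z
  have hext : ∀ ω : ℕ → S, ∀ i ≤ k, ω i = extendPath (fun j : Fin (k + 1) => ω j) i :=
    fun ω i hi => by simp [extendPath, hi]
  have huniq : ∀ (ω : ℕ → S) (w : Fin (k + 1) → S), (∀ i ≤ k, ω i = extendPath w i) →
      w = fun j : Fin (k + 1) => ω j := fun ω w h => by
    funext j
    have hj : (j : ℕ) ≤ k := by omega
    rw [h j hj]
    simp [extendPath, hj]
  have h1 : ∀ ω, F ω * g (ω k) (ω (k + 1)) = ∑ w : Fin (k + 1) → S, ∑ z,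
      {ω : ℕ → S | ∀ i ≤ k + 1, ω i = upd w z i}.indicator
        (fun _ => F (extendPath w) * g (extendPath w k) z) ω := fun ω => by
    rw [Finset.sum_eq_single (fun j : Fin (k + 1) => ω j), Finset.sum_eq_single (ω (k + 1))]
    · rw [Set.indicator_of_mem, ← hext ω k le_rfl, hF _ _ (hext ω)]
      intro i hi
      by_cases h : i ≤ k
      · simp [upd, h, ← hext ω i h]
      · have : i = k + 1 := by omega
        simp [upd, this]
    · intro z _ hz
      refine Set.indicator_of_notMem (fun h => hz ?_) _
      have := h (k + 1) le_rfl
      simpa [upd] using this.symm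
    · simp
    · intro w _ hw
      refine Finset.sum_eq_zero fun z _ => Set.indicator_of_notMem (fun h => hw ?_) _
      refine huniq ω w fun i hi => ?_
      have := h i (by omega)
      simpa [upd, hi] using this
    · simp
  have h2 : ∀ ω, F ω * ∑ z, ENNReal.ofReal (T (ω k) z) * g (ω k) z
      = ∑ w : Fin (k + 1) → S, {ω : ℕ → S | ∀ i ≤ k, ω i = extendPath w i}.indicator
        (fun _ => F (extendPath w) * ∑ z, ENNReal.ofReal (T (extendPath w k) z) *
          g (extendPath w k) z) ω := fun ω => by
    rw [Finset.sum_eq_single (fun j : Fin (k + 1) => ω j)]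
    · rw [Set.indicator_of_mem (by exact hext ω), ← hext ω k le_rfl, hF _ _ (hext ω)]
    · intro w _ hw
      exact Set.indicator_of_notMem (fun h => hw (huniq ω w (by exact h))) _
    · simp
  rw [lintegral_congr h1, lintegral_congr h2, lintegral_finsetSum _ fun w _ => Finset.measurable_sum _ fun z _ =>
      measurable_const.indicator (measurableSet_cylinder_le _ _),
    lintegral_finsetSum _ fun w _ => measurable_const.indicator (measurableSet_cylinder_le _ _)]
  refine Finset.sum_congr rfl fun w _ => ?_
  rw [lintegral_finsetSum _ fun z _ => measurable_const.indicator (measurableSet_cylinder_le _ _),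
    lintegral_indicator_const (measurableSet_cylinder_le _ _), Finset.mul_sum, Finset.sum_mul]
  refine Finset.sum_congr rfl fun z _ => ?_
  rw [lintegral_indicator_const (measurableSet_cylinder_le _ _), hρ]
  have h3 : {ω : ℕ → S | ∀ i ≤ k, ω i = upd w z i} = {ω | ∀ i ≤ k, ω i = extendPath w i} := by
    ext ω
    exact forall₂_congr fun i hi => by simp [upd, hi]
  have h4 : upd w z k = extendPath w k := by simp [upd]
  have h5 : upd w z (k + 1) = z := by simp [upd]
  rw [h3, h4, h5]
  ring

omit [Fintype S] in
theorem measurableSet_coord_eq (k : ℕ) (z : S) : MeasurableSet {ω : ℕ → S | ω k = z} :=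
  measurable_pi_apply k (measurableSet_singleton _)

theorem measure_markov_succ (hρ : IsMarkovChainLaw ρ T) (k : ℕ) (z : S) :
    ρ {ω | ω (k + 1) = z} = ∑ y, ρ {ω | ω k = y} * ENNReal.ofReal (T y z) := by
  classical
  have h := lintegral_markov_step hρ k (F := fun _ => 1) (fun _ _ _ => rfl)
    (fun _ b => if b = z then 1 else 0)
  simp only [one_mul, mul_ite, mul_one, mul_zero, Finset.sum_ite_eq', Finset.mem_univ, if_true] at h
  have h1 : ∀ ω : ℕ → S, (if ω (k + 1) = z then (1 : ℝ≥0∞) else 0)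
      = {ω | ω (k + 1) = z}.indicator 1 ω := fun ω => by
    simp [Set.indicator_apply]
  have h2 : ∀ ω : ℕ → S, ENNReal.ofReal (T (ω k) z)
      = ∑ y, {ω : ℕ → S | ω k = y}.indicator (fun _ => ENNReal.ofReal (T y z)) ω := fun ω => by
    simp [Set.indicator_apply]
  simp_rw [h1, h2] at h
  rw [lintegral_indicator_one (measurableSet_coord_eq _ _), lintegral_finsetSum _ fun y _ =>
    measurable_const.indicator (measurableSet_coord_eq _ _)] at h
  rw [h]
  refine Finset.sum_congr rfl fun y _ => ?_
  rw [lintegral_indicator_const (measurableSet_coord_eq _ _), mul_comm]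

/-- `IsMarkovChainLaw` does not ask `T` to be stochastic; conservation of mass forces it at the
visited states, up to negative entries, which `ENNReal.ofReal` discards. -/
theorem sum_ofReal_of_visited [IsProbabilityMeasure ρ] (hρ : IsMarkovChainLaw ρ T) {y : S}
    (hy : y ∈ visitedStates ρ) : ∑ z, ENNReal.ofReal (T y z) = 1 := by
  classical
  obtain ⟨k, hk⟩ := hy
  have h := lintegral_markov_step hρ k (F := fun ω => if ω k = y then 1 else 0)
    (fun ω ω' h => by simp only [h k le_rfl]) (fun _ _ => 1)
  have h2 : ∀ ω : ℕ → S, (if ω k = y then (1 : ℝ≥0∞) else 0) * ∑ z, ENNReal.ofReal (T (ω k) z) * 1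
      = {ω : ℕ → S | ω k = y}.indicator (fun _ => ∑ z, ENNReal.ofReal (T y z)) ω := fun ω => by
    by_cases h : ω k = y <;> simp [h]
  have h1 : ∀ ω : ℕ → S, (if ω k = y then (1 : ℝ≥0∞) else 0) * 1
      = {ω : ℕ → S | ω k = y}.indicator 1 ω := fun ω => by
    by_cases h : ω k = y <;> simp [h]
  simp_rw [h1, h2] at h
  rw [lintegral_indicator_one (measurableSet_coord_eq _ _),
    lintegral_indicator_const (measurableSet_coord_eq _ _)] at h
  have h3 : ρ {ω | ω k = y} * 1 = ρ {ω | ω k = y} * ∑ z, ENNReal.ofReal (T y z) := by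
    rw [mul_one, mul_comm]; exact h
  exact ((ENNReal.mul_right_inj hk (measure_ne_top _ _)).1 h3).symm

omit [MeasurableSingletonClass S] in
theorem visitedStates_nonempty [IsProbabilityMeasure ρ] : (visitedStates ρ).Nonempty := by
  by_contra h
  have h0 : ∀ z, ρ {ω | ω 0 = z} = 0 := fun z => by
    by_contra hz
    exact h ⟨z, 0, hz⟩
  have : ρ Set.univ ≤ 0 := by
    calc ρ Set.univ = ρ (⋃ z, {ω : ℕ → S | ω 0 = z}) := by
          congr 1; ext ω; simp
      _ ≤ ∑' z, ρ {ω : ℕ → S | ω 0 = z} := measure_iUnion_le _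
      _ = 0 := by simp [h0]
  simp at this

theorem visitedStates_closed (hρ : IsMarkovChainLaw ρ T) {y z : S}
    (hy : y ∈ visitedStates ρ) (hT : 0 < T y z) : z ∈ visitedStates ρ := by
  obtain ⟨k, hk⟩ := hy
  refine ⟨k + 1, ?_⟩
  rw [measure_markov_succ hρ]
  intro h
  have := Finset.sum_eq_zero_iff.1 h y (Finset.mem_univ _)
  rcases mul_eq_zero.1 this with h | h
  · exact hk h
  · exact absurd (ENNReal.ofReal_eq_zero.1 h) (not_le.2 hT)

theorem visitedStates_of_stepsTo (hρ : IsMarkovChainLaw ρ T) {k : ℕ} {y z : S}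
    (hy : y ∈ visitedStates ρ) (h : StepsTo (fun a b => 0 < T a b) k y z) :
    z ∈ visitedStates ρ := by
  induction k generalizing y with
  | zero => cases h; exact hy
  | succ k ih =>
    obtain ⟨w, hw, hwz⟩ := h
    exact ih (visitedStates_closed hρ hy hw) hwz

/-- The transition probabilities out of states that are never visited may be replaced so that the
matrix becomes stochastic, and positive in some power on the columns of the visited states. -/
theorem exists_normalized [DecidableEq S] [IsProbabilityMeasure ρ] (hρ : IsMarkovChainLaw ρ T)
    (hirr : IrreducibleOn (fun y z => 0 < T y z) (visitedStates ρ))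
    (hap : AperiodicOn (fun y z => 0 < T y z) (visitedStates ρ)) :
    ∃ T' : Matrix S S ℝ, IsMarkovChainLaw ρ T' ∧ T' ∈ rowStochastic ℝ S ∧
      ∃ N, ∀ y, ∀ z ∈ visitedStates ρ, 0 < (T' ^ N) y z := by
  classical
  obtain ⟨v, hv⟩ := visitedStates_nonempty (ρ := ρ)
  -- Unvisited states borrow the row of the visited state `v`. Truncating entries at 0 in `T'` does
  -- not affect the law.
  let b : S → S := fun y => if y ∈ visitedStates ρ then y else v
  have hb : ∀ y, b y ∈ visitedStates ρ := fun y => by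
    simp only [b]; split_ifs with h
    exacts [h, hv]
  have hbv : ∀ y ∈ visitedStates ρ, b y = y := fun y hy => if_pos hy
  let T' : Matrix S S ℝ := fun y z => max (T (b y) z) 0
  have hnn : ∀ y z, 0 ≤ T' y z := fun y z => le_max_right _ _
  have hrow : T' ∈ rowStochastic ℝ S := by
    rw [mem_rowStochastic_iff_sum]
    refine ⟨hnn, fun y => ?_⟩
    have h := sum_ofReal_of_visited hρ (hb y)
    have h2 : ∀ z, ENNReal.ofReal (T (b y) z) = ENNReal.ofReal (T' y z) := fun z => by
      simp [T', ENNReal.ofReal_max]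
    simp_rw [h2] at h
    rw [← ENNReal.ofReal_sum_of_nonneg fun z _ => hnn y z] at h
    exact ENNReal.ofReal_eq_one.1 h
  obtain ⟨N, hN⟩ := exists_forall_stepsTo hirr hap
  -- The exponent is `N + 1` so that there is a first step, in which the row of an arbitrary `y` can
  -- be replaced by that of `b y`.
  have hpos : ∀ y ∈ visitedStates ρ, ∀ z ∈ visitedStates ρ, 0 < (T' ^ (N + 1)) y z :=
    fun y hy z hz => by
      refine pow_apply_pos_of_stepsTo hnn ?_
      refine (hN (N + 1) (by omega) y hy z hz).congr_on (fun x hx w hw => ?_) hy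
      refine ⟨?_, visitedStates_closed hρ hx hw⟩
      simp only [T', hbv x hx]
      exact lt_max_of_lt_left hw
  refine ⟨T', fun k x => ?_, hrow, N + 1, fun y z hz => ?_⟩
  · rw [hρ]
    by_cases h0 : ρ {ω | ∀ i ≤ k, ω i = x i} = 0
    · simp [h0]
    · have hx : x k ∈ visitedStates ρ := ⟨k, fun h => h0 (measure_mono_null (fun ω hω => hω k le_rfl) h)⟩
      simp [T', hbv _ hx, ENNReal.ofReal_max]
  · have h : (T' ^ (N + 1)) y z = (T' ^ (N + 1)) (b y) z := by
      rw [pow_succ', mul_apply, mul_apply]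
      have : ∀ w, T' y w = T' (b y) w := fun w => by simp only [T', hbv _ (hb y)]
      simp_rw [this]
    rw [h]
    exact hpos _ (hb y) z hz

/-! #### Counts of visits and of jumps -/

/-- The number of visits to `y` at the times `k < M`. -/
def visits {S : Type*} [DecidableEq S] (w : ℕ → S) (M : ℕ) (y : S) : ℝ :=
  ∑ k ∈ Finset.range M, if w k = y then 1 else 0

/-- The number of jumps from `y` to `z` at the times `k < M`. -/
def jumps {S : Type*} [DecidableEq S] (w : ℕ → S) (M : ℕ) (y z : S) : ℝ :=
  ∑ k ∈ Finset.range M, if w k = y ∧ w (k + 1) = z then 1 else 0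

section Counts

variable {S : Type*} [DecidableEq S]

theorem visits_nonneg (w : ℕ → S) (M : ℕ) (y : S) : 0 ≤ visits w M y :=
  Finset.sum_nonneg fun _ _ => by split_ifs <;> norm_num

theorem sum_visits [Fintype S] (w : ℕ → S) (M : ℕ) : ∑ y, visits w M y = M := by
  simp only [visits]
  rw [Finset.sum_comm]
  simp

theorem sum_jumps [Fintype S] (w : ℕ → S) (M : ℕ) (z : S) :
    ∑ y, jumps w M y z = ∑ k ∈ Finset.range M, if w (k + 1) = z then 1 else 0 := by
  simp only [jumps]
  rw [Finset.sum_comm]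
  refine Finset.sum_congr rfl fun k _ => ?_
  simp [ite_and]

/-- Arrivals at the times 1, …, M and visits at the times 0, …, M - 1 differ only at the two ends.
-/
theorem abs_sum_jumps_sub_visits_le [Fintype S] (w : ℕ → S) (M : ℕ) (z : S) :
    |∑ y, jumps w M y z - visits w M z| ≤ 1 := by
  rw [sum_jumps, visits]
  have h := Finset.sum_range_succ' (fun k => if w k = z then (1 : ℝ) else 0) M
  rw [Finset.sum_range_succ] at h
  have h2 : (∑ k ∈ Finset.range M, if w (k + 1) = z then (1 : ℝ) else 0)
      - ∑ k ∈ Finset.range M, (if w k = z then (1 : ℝ) else 0)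
      = (if w M = z then 1 else 0) - if w 0 = z then 1 else 0 := by linarith
  rw [h2]
  split_ifs <;> norm_num

/-- If the jumps conform to the transition matrix `T`, the visits are nearly invariant. -/
theorem abs_sum_visits_mul_sub_le [Fintype S] {w : ℕ → S} {M : ℕ} {T : S → S → ℝ} {l : ℝ}
    (h : ∀ y z, |jumps w M y z - T y z * visits w M y| ≤ l) (z : S) :
    |∑ y, visits w M y * T y z - visits w M z| ≤ Fintype.card S * l + 1 := by
  have h1 := abs_sum_jumps_sub_visits_le w M z
  have h2 : |∑ y, (jumps w M y z - T y z * visits w M y)| ≤ Fintype.card S * l := by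
    refine (Finset.abs_sum_le_sum_abs _ _).trans ((Finset.sum_le_sum fun y _ => h y z).trans_eq ?_)
    simp
  have h3 : ∑ y, visits w M y * T y z - visits w M z
      = (∑ y, jumps w M y z - visits w M z) - ∑ y, (jumps w M y z - T y z * visits w M y) := by
    rw [Finset.sum_sub_distrib]
    simp only [mul_comm (T _ _)]
    ring
  rw [h3]
  exact (abs_sub _ _).trans (by linarith)

theorem visits_congr {w w' : ℕ → S} {M : ℕ} (h : ∀ k < M, w k = w' k) : visits w M = visits w' M :=
  funext fun _ => Finset.sum_congr rfl fun k hk => by rw [h k (Finset.mem_range.1 hk)]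

theorem jumps_congr {w w' : ℕ → S} {M : ℕ} (h : ∀ k ≤ M, w k = w' k) : jumps w M = jumps w' M :=
  funext fun _ => funext fun _ => Finset.sum_congr rfl fun k hk => by
    have := Finset.mem_range.1 hk
    rw [h k (by omega), h (k + 1) (by omega)]

end Counts

theorem measurable_path_fun {k : ℕ} {F : (ℕ → S) → ℝ≥0∞}
    (hF : ∀ ω ω', (∀ i ≤ k, ω i = ω' i) → F ω = F ω') : Measurable F := by
  have : F = (fun w : Fin (k + 1) → S => F (extendPath w)) ∘ fun ω i => ω i := by
    funext ω
    exact hF _ _ fun i hi => by simp [extendPath, hi]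
  rw [this]
  exact (measurable_of_countable _).comp (measurable_pi_lambda _ fun i => measurable_pi_apply _)

/-- The exponential moments of a martingale that is a sum of bounded functions of the jumps. -/
theorem lintegral_exp_sum_le [IsProbabilityMeasure ρ] (hρ : IsMarkovChainLaw ρ T)
    (hnn : ∀ y z, 0 ≤ T y z) (hsum : ∀ y, ∑ z, T y z = 1) {h : S → S → ℝ}
    (h1 : ∀ y z, |h y z| ≤ 1) (h0 : ∀ y, ∑ z, T y z * h y z = 0) {t : ℝ} (ht : |t| ≤ 1) (M : ℕ) :
    ∫⁻ ω, ENNReal.ofReal (Real.exp (t * ∑ k ∈ Finset.range M, h (ω k) (ω (k + 1)))) ∂ρ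
      ≤ ENNReal.ofReal (Real.exp (M * t ^ 2)) := by
  induction M with
  | zero => simp
  | succ M ih =>
    have hstep : ∀ y, ∑ z, ENNReal.ofReal (T y z) * ENNReal.ofReal (Real.exp (t * h y z))
        ≤ ENNReal.ofReal (Real.exp (t ^ 2)) := fun y => by
      simp_rw [← ENNReal.ofReal_mul (hnn y _)]
      rw [← ENNReal.ofReal_sum_of_nonneg fun z _ => mul_nonneg (hnn y z) (Real.exp_nonneg _)]
      refine ENNReal.ofReal_le_ofReal ?_
      -- From |exp x - 1 - x| ≤ x² for |x| ≤ 1; the linear term disappears on averaging over `z`, by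
      -- `h0`.
      have hb : ∀ z, T y z * Real.exp (t * h y z) ≤ T y z * (1 + t ^ 2) + t * (T y z * h y z) :=
        fun z => by
          have hth : |t * h y z| ≤ 1 := by
            rw [abs_mul]; exact mul_le_one₀ ht (abs_nonneg _) (h1 y z)
          have h2 := (abs_le.1 (Real.abs_exp_sub_one_sub_id_le hth)).2
          have h3 : (t * h y z) ^ 2 ≤ t ^ 2 := by
            rw [mul_pow]
            have : h y z ^ 2 ≤ 1 := (sq_le_one_iff_abs_le_one _).2 (h1 y z)
            nlinarith [sq_nonneg t]
          have h4 : Real.exp (t * h y z) ≤ 1 + t ^ 2 + t * h y z := by linarith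
          nlinarith [mul_le_mul_of_nonneg_left h4 (hnn y z)]
      calc ∑ z, T y z * Real.exp (t * h y z) ≤ ∑ z, (T y z * (1 + t ^ 2) + t * (T y z * h y z)) :=
            Finset.sum_le_sum fun z _ => hb z
        _ = 1 + t ^ 2 := by
            rw [Finset.sum_add_distrib, ← Finset.sum_mul, ← Finset.mul_sum, hsum, h0]; ring
        _ ≤ Real.exp (t ^ 2) := by linarith [Real.add_one_le_exp (t ^ 2)]
    let F : (ℕ → S) → ℝ≥0∞ := fun ω =>
      ENNReal.ofReal (Real.exp (t * ∑ k ∈ Finset.range M, h (ω k) (ω (k + 1))))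
    have hF : ∀ ω ω', (∀ i ≤ M, ω i = ω' i) → F ω = F ω' := fun ω ω' hω => by
      simp only [F]
      congr 3
      refine Finset.sum_congr rfl fun k hk => ?_
      have := Finset.mem_range.1 hk
      rw [hω k (by omega), hω (k + 1) (by omega)]
    calc ∫⁻ ω, ENNReal.ofReal (Real.exp (t * ∑ k ∈ Finset.range (M + 1), h (ω k) (ω (k + 1)))) ∂ρ
        = ∫⁻ ω, F ω * (fun a b => ENNReal.ofReal (Real.exp (t * h a b))) (ω M) (ω (M + 1)) ∂ρ := by
          refine lintegral_congr fun ω => ?_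
          rw [Finset.sum_range_succ, mul_add, Real.exp_add, ENNReal.ofReal_mul (Real.exp_nonneg _)]
      _ = ∫⁻ ω, F ω * ∑ z, ENNReal.ofReal (T (ω M) z) * ENNReal.ofReal (Real.exp (t * h (ω M) z)) ∂ρ :=
          lintegral_markov_step hρ M hF fun a b => ENNReal.ofReal (Real.exp (t * h a b))
      _ ≤ ∫⁻ ω, F ω * ENNReal.ofReal (Real.exp (t ^ 2)) ∂ρ :=
          lintegral_mono fun ω => mul_le_mul_right (hstep _) _
      _ = (∫⁻ ω, F ω ∂ρ) * ENNReal.ofReal (Real.exp (t ^ 2)) :=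
          lintegral_mul_const _ (measurable_path_fun hF)
      _ ≤ ENNReal.ofReal (Real.exp (M * t ^ 2)) * ENNReal.ofReal (Real.exp (t ^ 2)) :=
          mul_le_mul_left ih _
      _ = ENNReal.ofReal (Real.exp ((M + 1 : ℕ) * t ^ 2)) := by
          rw [← ENNReal.ofReal_mul (Real.exp_nonneg _), ← Real.exp_add]
          push_cast
          ring_nf

/-- Concentration of the jumps of a Markov chain, uniformly over all chains. -/
theorem measure_jumps_deviation_le [DecidableEq S] [IsProbabilityMeasure ρ]
    (hρ : IsMarkovChainLaw ρ T) (hnn : ∀ y z, 0 ≤ T y z) (hsum : ∀ y, ∑ z, T y z = 1)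
    {t : ℝ} (ht0 : 0 ≤ t) (ht : t ≤ 1) (M : ℕ) (l : ℝ) (y z : S) :
    ρ {ω | l ≤ |jumps ω M y z - T y z * visits ω M y|}
      ≤ 2 * ENNReal.ofReal (Real.exp (M * t ^ 2 - t * l)) := by
  have hT1 : T y z ≤ 1 := by
    rw [← hsum y]; exact Finset.single_le_sum (fun z _ => hnn y z) (Finset.mem_univ z)
  -- Jump indicators centred under `T`: the deviation becomes a sum of bounded martingale
  -- differences.
  let h : S → S → ℝ := fun a b => if a = y then (if b = z then 1 else 0) - T y z else 0
  have hD : ∀ ω : ℕ → S, jumps ω M y z - T y z * visits ω M y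
      = ∑ k ∈ Finset.range M, h (ω k) (ω (k + 1)) := fun ω => by
    rw [jumps, visits, Finset.mul_sum, ← Finset.sum_sub_distrib]
    refine Finset.sum_congr rfl fun k _ => ?_
    by_cases h1 : ω k = y <;> simp [h, h1]
  have h1 : ∀ a b, |h a b| ≤ 1 := fun a b => by
    have := hnn y z
    simp only [h]
    split_ifs <;> rw [abs_le] <;> constructor <;> linarith
  have h0 : ∀ a, ∑ b, T a b * h a b = 0 := fun a => by
    by_cases ha : a = y
    · subst ha
      simp [h, mul_sub, Finset.sum_sub_distrib, ← Finset.sum_mul, hsum]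
    · simp [h, ha]
  -- Chernoff's bound; `s = t` and `s = -t` cover the two tails.
  have key : ∀ s : ℝ, |s| = t → ρ {ω | t * l ≤ s * ∑ k ∈ Finset.range M, h (ω k) (ω (k + 1))}
      ≤ ENNReal.ofReal (Real.exp (M * t ^ 2 - t * l)) := fun s hs => by
    have hm := lintegral_exp_sum_le hρ hnn hsum h1 h0 (t := s) (by rw [hs]; exact ht) M
    rw [← sq_abs, hs] at hm
    have hmeas : Measurable fun ω : ℕ → S => ENNReal.ofReal
        (Real.exp (s * ∑ k ∈ Finset.range M, h (ω k) (ω (k + 1)))) :=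
      measurable_path_fun (k := M) fun ω ω' hω => by
        congr 3
        refine Finset.sum_congr rfl fun k hk => ?_
        have := Finset.mem_range.1 hk
        rw [hω k (by omega), hω (k + 1) (by omega)]
    have hc := (mul_meas_ge_le_lintegral (μ := ρ) hmeas (ENNReal.ofReal (Real.exp (t * l)))).trans hm
    have hset : {ω : ℕ → S | t * l ≤ s * ∑ k ∈ Finset.range M, h (ω k) (ω (k + 1))}
        = {ω | ENNReal.ofReal (Real.exp (t * l)) ≤ ENNReal.ofReal
        (Real.exp (s * ∑ k ∈ Finset.range M, h (ω k) (ω (k + 1))))} := by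
      ext ω
      simp [ENNReal.ofReal_le_ofReal_iff (Real.exp_nonneg _)]
    rw [hset, Real.exp_sub, ENNReal.ofReal_div_of_pos (Real.exp_pos _), ENNReal.le_div_iff_mul_le
      (Or.inl (by simp [Real.exp_pos])) (Or.inl ENNReal.ofReal_ne_top), mul_comm]
    exact hc
  have hsub : {ω : ℕ → S | l ≤ |jumps ω M y z - T y z * visits ω M y|}
      ⊆ {ω | t * l ≤ t * ∑ k ∈ Finset.range M, h (ω k) (ω (k + 1))}
        ∪ {ω | t * l ≤ -t * ∑ k ∈ Finset.range M, h (ω k) (ω (k + 1))} := fun ω hω => by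
    rw [Set.mem_ofPred_eq, hD] at hω
    rcases le_abs.1 hω with h2 | h2
    · exact Or.inl (mul_le_mul_of_nonneg_left h2 ht0)
    · refine Or.inr ?_
      have := mul_le_mul_of_nonneg_left h2 ht0
      rw [Set.mem_ofPred_eq]
      linarith
  refine (measure_mono hsub).trans ((measure_union_le _ _).trans ?_)
  rw [two_mul]
  exact add_le_add (key t (abs_of_nonneg ht0)) (key (-t) (by rw [abs_neg, abs_of_nonneg ht0]))

end MarkovLaw

/-! ### Limits of marginals and of visit frequencies for finite chains -/

section LawOfLargeNumbers

open Matrix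

variable {S : Type*} [Fintype S] [DecidableEq S] [MeasurableSpace S] [MeasurableSingletonClass S]
  {ρ : Measure (ℕ → S)} {T : S → S → ℝ}

theorem marginal_eq_vecMul_pow [IsProbabilityMeasure ρ] {T : Matrix S S ℝ}
    (hρ : IsMarkovChainLaw ρ T) (hT : ∀ y z, 0 ≤ T y z) (k : ℕ) :
    (fun z => ρ.real {ω | ω k = z}) = (fun z => ρ.real {ω | ω 0 = z}) ᵥ* T ^ k := by
  induction k with
  | zero => simp
  | succ k ih =>
    rw [pow_succ, ← vecMul_vecMul, ← ih]
    funext z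
    simp only [vecMul, dotProduct, measureReal_def]
    rw [measure_markov_succ hρ, ENNReal.toReal_sum fun y _ => ENNReal.mul_ne_top (measure_ne_top _ _)
      ENNReal.ofReal_ne_top]
    exact Finset.sum_congr rfl fun y _ => by
      rw [ENNReal.toReal_mul, ENNReal.toReal_ofReal (hT y z)]

omit [DecidableEq S] in
theorem sum_marginal [IsProbabilityMeasure ρ] (k : ℕ) : ∑ z, ρ.real {ω | ω k = z} = 1 := by
  have h := sum_measureReal_preimage_singleton (μ := ρ) (f := fun ω : ℕ → S => ω k) Finset.univ
    fun z _ => measurable_pi_apply k (measurableSet_singleton z)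
  simpa [Set.preimage] using h

theorem tendsto_mul_exp_neg_mul (C : ℝ) {b : ℝ} (hb : 0 < b) :
    Tendsto (fun M : ℕ => ENNReal.ofReal (C * Real.exp (-(b * M)))) atTop (𝓝 0) := by
  have h : Tendsto (fun M : ℕ => C * Real.exp (-(b * M))) atTop (𝓝 (C * 0)) :=
    (Real.tendsto_exp_neg_atTop_nhds_zero.comp
      (tendsto_natCast_atTop_atTop.const_mul_atTop hb)).const_mul C
  simpa using ENNReal.tendsto_ofReal h

/-- The convergence theorem and the ergodic theorem for finite Markov chains. -/
theorem exists_stationary [IsProbabilityMeasure ρ] (hρ : IsMarkovChainLaw ρ T)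
    (hirr : IrreducibleOn (fun y z => 0 < T y z) (visitedStates ρ))
    (hap : AperiodicOn (fun y z => 0 < T y z) (visitedStates ρ)) :
    ∃ π : S → ℝ, (∀ z, Tendsto (fun k => ρ.real {ω | ω k = z}) atTop (𝓝 (π z))) ∧
      (∀ z ∈ visitedStates ρ, 0 < π z) ∧
      ∀ ε > 0, Tendsto (fun M : ℕ => ρ {ω | ∃ z, ε * M ≤ |visits ω M z - M * π z|}) atTop (𝓝 0) := by
  obtain ⟨T', hρ', hT', N, hN⟩ := exists_normalized hρ hirr hap
  obtain ⟨z₀, hz₀⟩ := visitedStates_nonempty (ρ := ρ)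
  have hD : IsDoeblin T' := ⟨hT', N, z₀, fun y => hN y z₀ hz₀⟩
  have hnn : ∀ y z, 0 ≤ T' y z := fun y z => nonneg_of_mem_rowStochastic hT'
  obtain ⟨π, hπ, hπ1⟩ := hD.exists_invariant
  have hπN : ∀ k, π ᵥ* T' ^ k = π := fun k => by
    induction k with
    | zero => simp
    | succ k ih => rw [pow_succ, ← vecMul_vecMul, ih, hπ]
  have hlim : ∀ z, Tendsto (fun k => ρ.real {ω | ω k = z}) atTop (𝓝 (π z)) := fun z => by
    have h := hD.tendsto_vecMul_pow (x := (fun z => ρ.real {ω | ω 0 = z}) - π)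
      (by simp [sum_marginal, hπ1])
    rw [tendsto_iff_dist_tendsto_zero]
    refine squeeze_zero (fun _ => dist_nonneg) (fun k => ?_) h
    rw [sub_vecMul, ← marginal_eq_vecMul_pow hρ' hnn, hπN, Real.dist_eq]
    exact abs_le_lOne ((fun z => ρ.real {ω | ω k = z}) - π) z
  have hπ0 : ∀ z, 0 ≤ π z := fun z => ge_of_tendsto' (hlim z) fun _ => measureReal_nonneg
  refine ⟨π, hlim, fun z hz => ?_, fun ε hε => ?_⟩
  · obtain ⟨y, -, hy⟩ : ∃ y ∈ Finset.univ, 0 < π y :=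
      Finset.exists_lt_of_sum_lt (f := fun _ => (0 : ℝ)) (by simp [hπ1])
    rw [← hπN N]
    exact Finset.sum_pos' (fun x _ => mul_nonneg (hπ0 x) (nonneg_of_mem_rowStochastic (pow_mem hT' N)))
      ⟨y, Finset.mem_univ _, mul_pos hy (hN y z hz)⟩
  obtain ⟨K, hK, hKb⟩ := hD.exists_lOne_le
  set s : ℝ := (Fintype.card S : ℝ) with hs
  have hs0 : 0 ≤ s := Nat.cast_nonneg _
  -- If all jumps conform within a·M, near-invariance gives a visit error of at most K·s·(s·a·M +
  -- 1). The choice of `a` bounds the linear part by ε·M/4, and large `M` the rest, K·s, by ε·M/4.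
  -- Later t = a/2 minimizes M·t² - t·a·M.
  obtain ⟨a, ha0, ha1, haε⟩ : ∃ a : ℝ, 0 < a ∧ a ≤ 1 ∧ K * (s * (s * a)) ≤ ε / 4 := by
    refine ⟨min 1 (ε / (4 * K * (s + 1) ^ 2)), by positivity, min_le_left _ _, ?_⟩
    have h1 : min 1 (ε / (4 * K * (s + 1) ^ 2)) ≤ ε / (4 * K * (s + 1) ^ 2) := min_le_right _ _
    calc K * (s * (s * min 1 (ε / (4 * K * (s + 1) ^ 2))))
        ≤ K * ((s + 1) * ((s + 1) * (ε / (4 * K * (s + 1) ^ 2)))) := by gcongr <;> linarith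
      _ = ε / 4 := by field_simp
  have hbound : ∀ᶠ M : ℕ in atTop, ρ {ω | ∃ z, ε * M ≤ |visits ω M z - M * π z|}
      ≤ ENNReal.ofReal (s * s * 2 * Real.exp (-(a ^ 2 / 4 * M))) := by
    obtain ⟨M₀, hM₀⟩ := exists_nat_gt (K * s / (ε / 4))
    filter_upwards [eventually_ge_atTop M₀, eventually_gt_atTop 0] with M hM hMpos
    have hMpos' : (0 : ℝ) < M := Nat.cast_pos.2 hMpos
    have hMs : K * s ≤ ε / 4 * M := by
      have : K * s / (ε / 4) ≤ M := hM₀.le.trans (Nat.cast_le.2 hM)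
      rwa [div_le_iff₀ (by positivity), mul_comm (M : ℝ)] at this
    have hsub : {ω | ∃ z, ε * M ≤ |visits ω M z - M * π z|}
        ⊆ ⋃ q : S × S, {ω | a * M ≤ |jumps ω M q.1 q.2 - T' q.1 q.2 * visits ω M q.1|} := by
      rintro ω ⟨z, hz⟩
      by_contra hcon
      simp only [Set.mem_iUnion, Set.mem_ofPred_eq, not_exists, not_le, Prod.forall] at hcon
      have h1 := abs_sum_visits_mul_sub_le (T := T') fun y z => (hcon y z).le
      have h2 := hKb (visits ω M - (M : ℝ) • π)
        (by simp [Finset.sum_sub_distrib, sum_visits, ← Finset.mul_sum, hπ1])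
      have h3 : (visits ω M - (M : ℝ) • π) ᵥ* T' - (visits ω M - (M : ℝ) • π)
          = fun z => ∑ y, visits ω M y * T' y z - visits ω M z := by
        rw [sub_vecMul, smul_vecMul, hπ]
        funext z
        simp [vecMul, dotProduct]
      rw [h3] at h2
      have h4 : lOne (fun z => ∑ y, visits ω M y * T' y z - visits ω M z) ≤ s * (s * (a * M) + 1) := by
        refine (Finset.sum_le_sum fun z _ => h1 z).trans_eq ?_
        simp only [Finset.sum_const, Finset.card_univ, nsmul_eq_mul, hs]
      have h5 := (abs_le_lOne _ z).trans h2
      have h6 : |visits ω M z - M * π z| ≤ K * (s * (s * (a * M) + 1)) :=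
        h5.trans (mul_le_mul_of_nonneg_left h4 hK.le)
      nlinarith
    refine (measure_mono hsub).trans ((measure_iUnion_fintype_le _ _).trans ?_)
    refine (Finset.sum_le_sum fun q _ => measure_jumps_deviation_le hρ' hnn
      (fun y => sum_row_of_mem_rowStochastic hT' y) (t := a / 2) (by positivity) (by linarith) M (a * M)
      q.1 q.2).trans_eq ?_
    have hexp : M * (a / 2) ^ 2 - a / 2 * (a * M) = -(a ^ 2 / 4 * M) := by ring
    rw [hexp, Finset.sum_const, Finset.card_univ, Fintype.card_prod, nsmul_eq_mul,
      ENNReal.ofReal_mul (by positivity), ENNReal.ofReal_mul (by positivity),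
      ENNReal.ofReal_mul (by positivity), hs, ENNReal.ofReal_natCast]
    simp
    ring
  exact tendsto_of_tendsto_of_tendsto_of_le_of_le' tendsto_const_nhds
    (tendsto_mul_exp_neg_mul _ (by positivity)) (Eventually.of_forall fun _ => zero_le) hbound

omit [MeasurableSpace S] [MeasurableSingletonClass S] in
theorem visits_comp {S' : Type*} [DecidableEq S'] (f : S → S') (w : ℕ → S) (M : ℕ) (a : S') :
    visits (fun k => f (w k)) M a = ∑ z, if f z = a then visits w M z else 0 := by
  have h : ∀ z, (if f z = a then visits w M z else 0)
      = ∑ k ∈ Finset.range M, if f z = a ∧ w k = z then 1 else 0 := fun z => by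
    by_cases hz : f z = a <;> simp [visits, hz]
  simp_rw [h]
  rw [Finset.sum_comm, visits]
  refine Finset.sum_congr rfl fun k _ => ?_
  rw [Finset.sum_eq_single (w k)] <;> simp +contextual [eq_comm]

/-- The convergence theorem and the ergodic theorem for functions of finite Markov chains. -/
theorem exists_stationary_comp [IsProbabilityMeasure ρ] (hρ : IsMarkovChainLaw ρ T)
    (hirr : IrreducibleOn (fun y z => 0 < T y z) (visitedStates ρ))
    (hap : AperiodicOn (fun y z => 0 < T y z) (visitedStates ρ))
    {S' : Type*} [DecidableEq S'] (f : S → S') :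
    ∃ π : S' → ℝ, (∀ a, Tendsto (fun k => ρ.real {ω | f (ω k) = a}) atTop (𝓝 (π a))) ∧
      ∀ ε > 0, Tendsto (fun M : ℕ =>
        ρ {ω | ∃ a, ε * M ≤ |visits (fun k => f (ω k)) M a - M * π a|}) atTop (𝓝 0) := by
  obtain ⟨π, h1, -, h2⟩ := exists_stationary hρ hirr hap
  refine ⟨fun a => ∑ z, if f z = a then π z else 0, fun a => ?_, fun ε hε => ?_⟩
  · have h : ∀ k, ρ.real {ω | f (ω k) = a} = ∑ z, if f z = a then ρ.real {ω | ω k = z} else 0 :=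
      fun k => by
        have := sum_measureReal_preimage_singleton (μ := ρ) (f := fun ω : ℕ → S => ω k)
          (Finset.univ.filter fun z => f z = a)
          fun z _ => measurable_pi_apply k (measurableSet_singleton z)
        rw [Finset.sum_filter] at this
        simpa [Set.preimage] using this.symm
    simp_rw [h]
    refine tendsto_finsetSum _ fun z _ => ?_
    split_ifs
    exacts [h1 z, tendsto_const_nhds]
  · set s : ℝ := (Fintype.card S : ℝ) with hs
    have hs0 : 0 ≤ s := Nat.cast_nonneg _
    refine tendsto_of_tendsto_of_tendsto_of_le_of_le' tendsto_const_nhds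
      (h2 (ε / (s + 1)) (by positivity)) (Eventually.of_forall fun _ => zero_le) ?_
    filter_upwards [eventually_gt_atTop 0] with M hM
    have hM' : (0 : ℝ) < M := Nat.cast_pos.2 hM
    refine measure_mono ?_
    rintro ω ⟨a, ha⟩
    by_contra hcon
    simp only [Set.mem_ofPred_eq, not_exists, not_le] at hcon
    rw [visits_comp, Finset.mul_sum, ← Finset.sum_sub_distrib] at ha
    have h3 : |∑ z, ((if f z = a then visits ω M z else 0) - M * if f z = a then π z else 0)|
        ≤ s * (ε / (s + 1) * M) := by
      refine (Finset.abs_sum_le_sum_abs _ _).trans ((Finset.sum_le_sum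
        (g := fun _ => ε / (s + 1) * M) fun z _ => ?_).trans_eq (by simp [hs]))
      split_ifs
      · exact (hcon z).le
      · simp only [mul_zero, sub_zero, abs_zero]; positivity
    have h4 : s * (ε / (s + 1) * M) < ε * M := by
      rw [← mul_assoc]
      refine mul_lt_mul_of_pos_right ?_ hM'
      rw [← mul_div_assoc, div_lt_iff₀ (by positivity)]
      nlinarith
    linarith

end LawOfLargeNumbers

/-! ### Transition matrices -/

section TransitionMatrix

open Matrix

variable {r : ℕ} {E : Finset (Fin r × Fin r)} {o : Fin r → Fin r} {x : Param E o}

theorem sum_freeEdge_row (x : Param E o) (i : Fin r) :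
    ∑ l, (if h : (i, l) ∈ E ∧ l ≠ o i then x ⟨(i, l), h⟩ else 0) = rowSum x i := by
  let g : Fin r × Fin r → ℝ := fun e => if h : e ∈ E ∧ e.2 ≠ o e.1 then x ⟨e, h⟩ else 0
  have h1 : rowSum x i = ∑ e : FreeEdge E o, if e.1.1 = i then g e.1 else 0 := by
    refine Finset.sum_congr rfl fun e _ => ?_
    have : g e.1 = x e := dif_pos e.2
    rw [this]
  rw [h1, ← Finset.sum_subtype (Finset.univ.filter fun e : Fin r × Fin r => e ∈ E ∧ e.2 ≠ o e.1)
    (by simp) (fun e => if e.1 = i then g e else 0), Finset.sum_filter_of_ne, Fintype.sum_prod_type]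
  · symm
    rw [Finset.sum_eq_single i]
    · simp only [if_true, g]
    · intro j _ hj
      simp only [hj, if_false, Finset.sum_const_zero]
    · simp
  · intro e _ he
    by_contra hcon
    simp [g, hcon] at he

/-- The matrix of `transitionMatrix`. -/
def userMatrix (x : Param E o) : Matrix (Fin r) (Fin r) ℝ := Matrix.of (transitionMatrix x)

theorem userMatrix_apply (x : Param E o) (i l : Fin r) :
    userMatrix x i l = transitionMatrix x i l := rfl

theorem userMatrix_mem_rowStochastic (hx : x ∈ paramRegion E o) :
    userMatrix x ∈ rowStochastic ℝ (Fin r) := by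
  rw [mem_rowStochastic_iff_sum]
  refine ⟨fun i l => ?_, fun i => ?_⟩
  · rw [userMatrix_apply, transitionMatrix]
    split_ifs
    exacts [(hx.1 _).le, sub_nonneg.2 (hx.2 i).le, le_rfl]
  · have h : ∀ l, transitionMatrix x i l = (if h : (i, l) ∈ E ∧ l ≠ o i then x ⟨(i, l), h⟩ else 0)
        + if l = o i then 1 - rowSum x i else 0 := fun l => by
      rw [transitionMatrix]
      by_cases hl : l = o i <;> by_cases hE : (i, l) ∈ E <;> simp [hl]
    simp_rw [userMatrix_apply, h]
    rw [Finset.sum_add_distrib, sum_freeEdge_row]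
    simp

theorem transitionMatrix_pos (hx : x ∈ paramRegion E o) {i l : Fin r}
    (h : (i, l) ∈ E) : 0 < transitionMatrix x i l := by
  rw [transitionMatrix]
  split_ifs with h1 h2
  · exact hx.1 _
  · exact sub_pos.2 (hx.2 i)
  · exact absurd ⟨h, h2⟩ h1

theorem mem_of_transitionMatrix_pos (ho : ∀ i, (i, o i) ∈ E) {i l : Fin r}
    (h : 0 < transitionMatrix x i l) : (i, l) ∈ E := by
  rw [transitionMatrix] at h
  split_ifs at h with h1 h2
  · exact h1.1
  · rw [h2]; exact ho i
  · exact absurd h (lt_irrefl _)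

theorem transitionMatrix_pos_iff (ho : ∀ i, (i, o i) ∈ E) (hx : x ∈ paramRegion E o) :
    (fun i l => 0 < transitionMatrix x i l) = fun i l => (i, l) ∈ E :=
  funext fun _ => funext fun _ =>
    propext ⟨mem_of_transitionMatrix_pos ho, transitionMatrix_pos hx⟩

theorem transitionMatrix_freeEdge (x : Param E o) (e : FreeEdge E o) :
    transitionMatrix x e.1.1 e.1.2 = x e := dif_pos e.2

theorem card_freeEdge (ho : ∀ i, (i, o i) ∈ E) : Fintype.card (FreeEdge E o) + r = E.card := by
  rw [Fintype.card_subtype, ← Finset.card_filter_add_card_filter_not (s := E) fun e => e.2 ≠ o e.1]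
  congr 1
  · congr 1; ext e; simp
  · have : E.filter (fun e => ¬ e.2 ≠ o e.1) = Finset.univ.image fun i => (i, o i) := by
      ext ⟨i, l⟩
      simp only [not_not, Finset.mem_filter, Finset.mem_image, Finset.mem_univ, true_and,
        Prod.mk.injEq]
      constructor
      · rintro ⟨-, rfl⟩; exact ⟨i, rfl, rfl⟩
      · rintro ⟨j, rfl, rfl⟩; exact ⟨ho j, rfl⟩
    rw [this, Finset.card_image_of_injective _ fun i j h => (Prod.ext_iff.1 h).1]
    simp

/-- All admissible matrices share the graph `E`, so one exponent makes the powers of both factors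
positive. Irreducibility alone would not suffice: a product of periodic chains can be reducible. -/
theorem isDoeblin_prodMatrix (ho : ∀ i, (i, o i) ∈ E)
    (h_irr : IrreducibleOn (fun i l => (i, l) ∈ E) Set.univ)
    (h_aper : AperiodicOn (fun i l => (i, l) ∈ E) Set.univ) {x y : Param E o}
    (hx : x ∈ paramRegion E o) (hy : y ∈ paramRegion E o) (i₀ : Fin r) :
    IsDoeblin (prodMatrix (userMatrix x) (userMatrix y)) := by
  obtain ⟨N, hN⟩ := exists_forall_stepsTo h_irr h_aper
  have h : ∀ z ∈ paramRegion E o, ∀ i l,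
      0 < (userMatrix z ^ N) i l := fun z hz i l => by
    refine pow_apply_pos_of_stepsTo (fun _ _ => nonneg_of_mem_rowStochastic
      (userMatrix_mem_rowStochastic hz)) ?_
    simp_rw [userMatrix_apply, transitionMatrix_pos_iff ho hz]
    exact hN N le_rfl i trivial l trivial
  refine ⟨prodMatrix_mem_rowStochastic (userMatrix_mem_rowStochastic hx)
    (userMatrix_mem_rowStochastic hy), N, (i₀, i₀), fun z => ?_⟩
  rw [prodMatrix_pow]
  exact mul_pos (h x hx _ _) (h y hy _ _)

end TransitionMatrix

/-! ### The data of single users and of pairs of users -/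

section Users

open Matrix

variable {r : ℕ} {E : Finset (Fin r × Fin r)} {o : Fin r → Fin r} {G : SimpleGraph ℕ}
  {p : ℕ → Param E o} {ρ : Measure (Traces r)}

/-- The joint trace of two users. -/
def pairTrace (x : Traces r) (u v : ℕ) : ℕ → Fin r × Fin r := fun k => (x u k, x v k)

theorem measurable_pairTrace (u v : ℕ) : Measurable fun x : Traces r => pairTrace x u v := by
  unfold pairTrace
  fun_prop

theorem measurable_groupTrace (C : Set ℕ) : Measurable (groupTrace (r := r) C) := by
  unfold groupTrace
  fun_prop

theorem invariant_of_tendsto {S : Type*} [Fintype S] [DecidableEq S] [MeasurableSpace S]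
    [MeasurableSingletonClass S] {ρ : Measure (ℕ → S)} [IsProbabilityMeasure ρ] {T : Matrix S S ℝ}
    (hρ : IsMarkovChainLaw ρ T) (hT : ∀ y z, 0 ≤ T y z) {π : S → ℝ}
    (hπ : ∀ z, Tendsto (fun k => ρ.real {ω | ω k = z}) atTop (𝓝 (π z))) : π ᵥ* T = π := by
  funext z
  refine tendsto_nhds_unique ?_ ((tendsto_add_atTop_iff_nat 1).2 (hπ z))
  have h : ∀ k, ρ.real {ω | ω (k + 1) = z} = ∑ y, ρ.real {ω | ω k = y} * T y z := fun k => by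
    have h1 := congrFun (marginal_eq_vecMul_pow hρ hT (k + 1)) z
    rw [pow_succ, ← vecMul_vecMul, ← marginal_eq_vecMul_pow hρ hT k] at h1
    exact h1
  simp_rw [h]
  exact tendsto_finsetSum _ fun y _ => (hπ y).mul_const _

theorem IsDataLaw.exists_user_stationary [IsProbabilityMeasure ρ] (hρ : IsDataLaw G p ρ)
    (h_irr : IrreducibleOn (fun i l => (i, l) ∈ E) Set.univ)
    (h_aper : AperiodicOn (fun i l => (i, l) ∈ E) Set.univ)
    (ho : ∀ i, (i, o i) ∈ E) {v : ℕ} (hv : p v ∈ paramRegion E o) :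
    ∃ π : Fin r → ℝ, (∀ i, Tendsto (fun k => ρ.real {x | x v k = i}) atTop (𝓝 (π i))) ∧
      (∀ i, 0 < π i) ∧ π ᵥ* userMatrix (p v) = π ∧ ∑ i, π i = 1 ∧
      ∀ ε > 0, Tendsto (fun M : ℕ => ρ {x | ∃ i, ε * M ≤ |visits (x v) M i - M * π i|})
        atTop (𝓝 0) := by
  have hm : Measurable fun x : Traces r => x v := measurable_pi_apply v
  have : IsProbabilityMeasure (ρ.map fun x : Traces r => x v) :=
    Measure.isProbabilityMeasure_map hm.aemeasurable
  have hM := hρ.user_markov v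
  have hE := transitionMatrix_pos_iff ho hv
  have hvis : visitedStates (ρ.map fun x : Traces r => x v) = Set.univ := by
    obtain ⟨y, hy⟩ := visitedStates_nonempty (ρ := ρ.map fun x : Traces r => x v)
    refine Set.eq_univ_of_forall fun z => ?_
    obtain ⟨k, hk⟩ := h_irr y trivial z trivial
    exact visitedStates_of_stepsTo hM hy (by rw [hE]; exact hk)
  obtain ⟨π, h1, h2, h3⟩ := exists_stationary hM (by rw [hE, hvis]; exact h_irr)
    (by rw [hE, hvis]; exact h_aper)
  have hreal : ∀ k i, (ρ.map fun x : Traces r => x v).real {ω | ω k = i} = ρ.real {x | x v k = i} :=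
    fun k i => map_measureReal_apply hm (measurableSet_coord_eq k i)
  refine ⟨π, ?_, fun i => h2 i (by rw [hvis]; trivial), invariant_of_tendsto (T := userMatrix (p v)) hM
    (fun y z => nonneg_of_mem_rowStochastic (userMatrix_mem_rowStochastic hv)) h1, ?_, fun ε hε => ?_⟩
  · simp_rw [hreal] at h1
    exact h1
  · refine tendsto_nhds_unique (tendsto_finsetSum _ fun i _ => h1 i) ?_
    simp_rw [sum_marginal]
    exact tendsto_const_nhds
  · exact tendsto_of_tendsto_of_tendsto_of_le_of_le tendsto_const_nhds (h3 ε hε)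
      (fun _ => zero_le) fun M => Measure.le_map_apply hm.aemeasurable _

/-- Each user visits each state in a positive fraction of the time. -/
theorem IsDataLaw.exists_tendsto_visits [IsProbabilityMeasure ρ] (hρ : IsDataLaw G p ρ)
    (h_irr : IrreducibleOn (fun i l => (i, l) ∈ E) Set.univ)
    (h_aper : AperiodicOn (fun i l => (i, l) ∈ E) Set.univ)
    (ho : ∀ i, (i, o i) ∈ E) (i₀ : Fin r) {v : ℕ} (hv : p v ∈ paramRegion E o) :
    ∃ η > 0, Tendsto (fun M : ℕ => ρ {x | ∃ i, visits (x v) M i ≤ η * M}) atTop (𝓝 0) := by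
  obtain ⟨π, -, h2, -, -, h3⟩ := hρ.exists_user_stationary h_irr h_aper ho hv
  have : Nonempty (Fin r) := ⟨i₀⟩
  obtain ⟨j, hj⟩ := Finite.exists_min π
  refine ⟨π j / 2, half_pos (h2 j), tendsto_of_tendsto_of_tendsto_of_le_of_le tendsto_const_nhds
    (h3 (π j / 2) (half_pos (h2 j))) (fun _ => zero_le) fun M => measure_mono ?_⟩
  rintro x ⟨i, hi⟩
  refine ⟨i, le_abs.2 (Or.inr ?_)⟩
  have := mul_le_mul_of_nonneg_left (hj i) (Nat.cast_nonneg (α := ℝ) M)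
  linarith

/-- The mutual information vanishes in the limit if the joint law converges to a product with
positive factors. -/
theorem tendsto_mutualInformation_zero {A B : ℕ → Traces r → Fin r} {a b : Fin r → ℝ}
    (ha : ∀ i, 0 < a i) (hb : ∀ i, 0 < b i)
    (hA : ∀ i, Tendsto (fun k => ρ.real {x | A k x = i}) atTop (𝓝 (a i)))
    (hB : ∀ i, Tendsto (fun k => ρ.real {x | B k x = i}) atTop (𝓝 (b i)))
    (hAB : ∀ i j, Tendsto (fun k => ρ.real {x | A k x = i ∧ B k x = j}) atTop (𝓝 (a i * b j))) :
    Tendsto (fun k => mutualInformation ρ (A k) (B k)) atTop (𝓝 0) := by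
  have h0 : (0 : ℝ) = ∑ i, ∑ j, a i * b j * Real.log (a i * b j / (a i * b j)) := by
    refine (Finset.sum_eq_zero fun i _ => Finset.sum_eq_zero fun j _ => ?_).symm
    rw [div_self (mul_pos (ha i) (hb j)).ne', Real.log_one, mul_zero]
  rw [h0]
  refine tendsto_finsetSum _ fun i _ => tendsto_finsetSum _ fun j _ => (hAB i j).mul ?_
  have hij := mul_pos (ha i) (hb j)
  exact ((hAB i j).div ((hA i).mul (hB j)) hij.ne').log (by rw [div_self hij.ne']; exact one_ne_zero)

/-- The joint trace of two associated users is not nearly invariant under the transition matrix of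
two independent users. -/
theorem IsDataLaw.exists_tendsto_defect [IsProbabilityMeasure ρ] (hρ : IsDataLaw G p ρ)
    (h_irr : IrreducibleOn (fun i l => (i, l) ∈ E) Set.univ)
    (h_aper : AperiodicOn (fun i l => (i, l) ∈ E) Set.univ)
    (ho : ∀ i, (i, o i) ∈ E) (i₀ : Fin r) {u v : ℕ} (hu : p u ∈ paramRegion E o)
    (hv : p v ∈ paramRegion E o) (huv : G.Adj u v) (hfin : (G.connectedComponentMk u).supp.Finite) :
    ∃ η > 0, Tendsto (fun M : ℕ => ρ {x | ∀ z,
      |∑ y, visits (pairTrace x u v) M y * prodMatrix (userMatrix (p u)) (userMatrix (p v)) y z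
        - visits (pairTrace x u v) M z| < η * M}) atTop (𝓝 0) := by
  classical
  set K := prodMatrix (userMatrix (p u)) (userMatrix (p v)) with hK
  set C := G.connectedComponentMk u with hC
  have : Fintype C.supp := hfin.fintype
  have hm := measurable_groupTrace (r := r) C.supp
  have : IsProbabilityMeasure (ρ.map (groupTrace C.supp)) :=
    Measure.isProbabilityMeasure_map hm.aemeasurable
  obtain ⟨T, hT, hTi, hTa⟩ := hρ.group_markov C
  have huC : u ∈ C.supp := rfl
  have hvC : v ∈ C.supp := SimpleGraph.ConnectedComponent.sound huv.reachable.symm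
  -- The pair of users need not be a Markov chain, but it is a function of the chain of its group.
  obtain ⟨π, hπ, hπv⟩ := exists_stationary_comp hT hTi hTa
    fun z : C.supp → Fin r => (z ⟨u, huC⟩, z ⟨v, hvC⟩)
  obtain ⟨a, ha, ha0, hainv, ha1, -⟩ := hρ.exists_user_stationary h_irr h_aper ho hu
  obtain ⟨b, hb, hb0, hbinv, hb1, -⟩ := hρ.exists_user_stationary h_irr h_aper ho hv
  have hKs : K ∈ rowStochastic ℝ (Fin r × Fin r) := prodMatrix_mem_rowStochastic
    (userMatrix_mem_rowStochastic hu) (userMatrix_mem_rowStochastic hv)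
  have hJ : ∀ i j, Tendsto (fun k => ρ.real {x | x u k = i ∧ x v k = j}) atTop (𝓝 (π (i, j))) :=
    fun i j => by
      refine (hπ (i, j)).congr fun k => ?_
      rw [map_measureReal_apply hm]
      · congr 1
        ext x
        simp [groupTrace]
      · exact (measurable_pi_apply (X := fun _ : ℕ => C.supp → Fin r) k) (MeasurableSet.of_discrete
          (s := {z : C.supp → Fin r | (z ⟨u, huC⟩, z ⟨v, hvC⟩) = (i, j)}))
  have hπ1 : ∑ z, π z = 1 := by
    refine tendsto_nhds_unique (tendsto_finsetSum _ fun z _ => hJ z.1 z.2) ?_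
    have h : ∀ k, ∑ z : Fin r × Fin r, ρ.real {x : Traces r | x u k = z.1 ∧ x v k = z.2} = 1 :=
      fun k => by
        have := sum_measureReal_preimage_singleton (μ := ρ) (f := fun x : Traces r => pairTrace x u v k)
          Finset.univ fun z _ => ((measurable_pi_apply k).comp (measurable_pairTrace u v))
            (measurableSet_singleton z)
        simpa [Set.preimage, pairTrace, Prod.ext_iff] using this
    simp_rw [h]
    exact tendsto_const_nhds
  -- Otherwise the limit law of the pair would, by uniqueness, be the product of the marginal
  -- limits, so the mutual information would tend to 0, against association.
  obtain ⟨z, hz⟩ : ∃ z, ∑ y, π y * K y z - π z ≠ 0 := by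
    by_contra hcon
    push Not at hcon
    have hinv : π ᵥ* K = π := funext fun z => sub_eq_zero.1 (hcon z)
    have hinv2 : (fun z : Fin r × Fin r => a z.1 * b z.2) ᵥ* K = fun z => a z.1 * b z.2 := by
      funext z
      conv_rhs => rw [← hainv, ← hbinv]
      simp only [vecMul, dotProduct, hK, prodMatrix, Fintype.sum_prod_type, Finset.sum_mul_sum]
      exact Finset.sum_congr rfl fun _ _ => Finset.sum_congr rfl fun _ _ => by ring
    have hprod := (isDoeblin_prodMatrix ho h_irr h_aper hu hv i₀).eq_of_invariant hinv hinv2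
      (by rw [hπ1, Fintype.sum_prod_type]; simp [← Finset.mul_sum, ha1, hb1])
    rw [hprod] at hJ
    have hMI := tendsto_mutualInformation_zero (A := fun k x => x u k) (B := fun k x => x v k)
      ha0 hb0 ha hb hJ
    obtain ⟨η, hη, hev⟩ := (hρ.association u v huv.ne).1 huv
    exact absurd (ge_of_tendsto hMI hev) (not_le.2 hη)
  set d := |∑ y, π y * K y z - π z| with hd
  have hd0 : 0 < d := abs_pos.2 hz
  set s : ℝ := (Fintype.card (Fin r × Fin r) : ℝ) with hs
  have hs0 : 0 ≤ s := Nat.cast_nonneg _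
  -- The limiting defect is d·M. Visit errors of at most d/2/(s+1)·M enter s times through the sum
  -- and once through the subtracted count, altering it by at most d/2·M.
  refine ⟨d / 2, half_pos hd0, tendsto_of_tendsto_of_tendsto_of_le_of_le' tendsto_const_nhds
    (hπv (d / 2 / (s + 1)) (by positivity)) (Eventually.of_forall fun _ => zero_le) ?_⟩
  filter_upwards with M
  refine (measure_mono ?_).trans (Measure.le_map_apply hm.aemeasurable _)
  intro x hx
  by_contra hcon
  simp only [Set.mem_preimage, Set.mem_ofPred_eq, not_exists, not_le] at hcon
  have hv1 : ∀ y, |visits (pairTrace x u v) M y - M * π y| ≤ d / 2 / (s + 1) * M :=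
    fun y => (hcon y).le
  have hx1 := hx z
  have h1 : |∑ y, (visits (pairTrace x u v) M y - M * π y) * K y z| ≤ s * (d / 2 / (s + 1) * M) := by
    refine (Finset.abs_sum_le_sum_abs _ _).trans ((Finset.sum_le_sum
      (g := fun _ => d / 2 / (s + 1) * M) fun y _ => ?_).trans_eq (by simp [hs]))
    rw [abs_mul, abs_of_nonneg (nonneg_of_mem_rowStochastic hKs)]
    exact (mul_le_of_le_one_right (abs_nonneg _) (le_one_of_mem_rowStochastic hKs)).trans (hv1 y)
  have h2 : s * (d / 2 / (s + 1) * M) + d / 2 / (s + 1) * M = d / 2 * M := by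
    field_simp
  have h3 : ∑ y, (visits (pairTrace x u v) M y - M * π y) * K y z
      = ∑ y, visits (pairTrace x u v) M y * K y z - M * ∑ y, π y * K y z := by
    rw [Finset.mul_sum, ← Finset.sum_sub_distrib]
    exact Finset.sum_congr rfl fun _ _ => by ring
  have h4 : d * M = |M * (∑ y, π y * K y z - π z)| := by
    rw [abs_mul, Nat.abs_cast, hd, mul_comm]
  have h5 : M * (∑ y, π y * K y z - π z)
      = (∑ y, visits (pairTrace x u v) M y * K y z - visits (pairTrace x u v) M z)
        - ∑ y, (visits (pairTrace x u v) M y - M * π y) * K y z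
        + (visits (pairTrace x u v) M z - M * π z) := by rw [h3]; ring
  have h6 := hv1 z
  rw [h5] at h4
  have h7 := (abs_add_le ((∑ y, visits (pairTrace x u v) M y * K y z - visits (pairTrace x u v) M z)
    - ∑ y, (visits (pairTrace x u v) M y - M * π y) * K y z) (visits (pairTrace x u v) M z - M * π z))
  have h8 := abs_sub (∑ y, visits (pairTrace x u v) M y * K y z - visits (pairTrace x u v) M z)
    (∑ y, (visits (pairTrace x u v) M y - M * π y) * K y z)
  linarith

theorem IsDataLaw.pair_markov (hρ : IsDataLaw G p ρ)
    {u v : ℕ} (hu : p u ∈ paramRegion E o) (huv : ¬ G.Reachable u v) :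
    IsMarkovChainLaw (ρ.map fun x => pairTrace x u v)
      (prodMatrix (userMatrix (p u)) (userMatrix (p v))) := by
  have key : ∀ k (w : ℕ → Fin r × Fin r),
      (ρ.map fun x => pairTrace x u v) {ω | ∀ i ≤ k, ω i = w i}
      = (ρ.map fun x => x u) {ω | ∀ i ≤ k, ω i = (w i).1}
        * (ρ.map fun x => x v) {ω | ∀ i ≤ k, ω i = (w i).2} := fun k w => by
    rw [Measure.map_apply (measurable_pairTrace u v) (measurableSet_cylinder_le _ _),
      Measure.map_apply (measurable_pi_apply u) (measurableSet_cylinder_le k fun i => (w i).1),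
      Measure.map_apply (measurable_pi_apply v) (measurableSet_cylinder_le k fun i => (w i).2),
      ← (hρ.indep u v huv).measure_inter_preimage_eq_mul _ _
        (measurableSet_cylinder_le k fun i => (w i).1)
        (measurableSet_cylinder_le k fun i => (w i).2)]
    congr 1
    ext x
    simp [pairTrace, Prod.ext_iff, forall_and]
  intro k w
  rw [key, key, hρ.user_markov u k fun i => (w i).1, hρ.user_markov v k fun i => (w i).2]
  have : prodMatrix (userMatrix (p u)) (userMatrix (p v)) (w k) (w (k + 1))
    = transitionMatrix (p u) (w k).1 (w (k + 1)).1 * transitionMatrix (p v) (w k).2 (w (k + 1)).2 := rfl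
  have h0 : 0 ≤ transitionMatrix (p u) (w k).1 (w (k + 1)).1 :=
    nonneg_of_mem_rowStochastic (userMatrix_mem_rowStochastic hu)
  rw [this, ENNReal.ofReal_mul h0]
  ring

/-- Jumps deviate from the transition matrix `T` by less than `l`. -/
def Conforms {S : Type*} [DecidableEq S] (T : S → S → ℝ) (M : ℕ) (l : ℝ) (w : ℕ → S) : Prop :=
  ∀ y z, |jumps w M y z - T y z * visits w M y| < l

theorem measure_not_conforms_le {S : Type*} [Fintype S] [DecidableEq S] [MeasurableSpace S]
    [MeasurableSingletonClass S] {ρ : Measure (ℕ → S)} [IsProbabilityMeasure ρ] {T : Matrix S S ℝ}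
    (hρ : IsMarkovChainLaw ρ T) (hT : T ∈ rowStochastic ℝ S) {t : ℝ} (ht0 : 0 ≤ t) (ht : t ≤ 1)
    (M : ℕ) (l : ℝ) :
    ρ {ω | ¬ Conforms T M l ω} ≤ ENNReal.ofReal
      (2 * (Fintype.card S) ^ 2 * Real.exp (M * t ^ 2 - t * l)) := by
  have hsub : {ω | ¬ Conforms T M l ω}
      ⊆ ⋃ q : S × S, {ω | l ≤ |jumps ω M q.1 q.2 - T q.1 q.2 * visits ω M q.1|} := fun ω hω => by
    simp only [Conforms, Set.mem_ofPred_eq, not_forall, not_lt] at hω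
    obtain ⟨y, z, h⟩ := hω
    exact Set.mem_iUnion.2 ⟨(y, z), h⟩
  refine (measure_mono hsub).trans ((measure_iUnion_fintype_le _ _).trans ?_)
  refine (Finset.sum_le_sum fun q _ => measure_jumps_deviation_le hρ
    (fun _ _ => nonneg_of_mem_rowStochastic hT) (fun y => sum_row_of_mem_rowStochastic hT y) ht0 ht M l
    q.1 q.2).trans_eq ?_
  rw [Finset.sum_const, Finset.card_univ, Fintype.card_prod, nsmul_eq_mul,
    ENNReal.ofReal_mul (by positivity), ENNReal.ofReal_mul (by positivity),
    ENNReal.ofReal_pow (by positivity), ENNReal.ofReal_natCast]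
  simp
  ring

end Users

/-! ### The estimator -/

section EstimatorConstruction

open Matrix

variable {r : ℕ} {E : Finset (Fin r × Fin r)} {o : Fin r → Fin r}

theorem measurable_transitionMatrix (i l : Fin r) :
    Measurable fun x : Param E o => transitionMatrix x i l := by
  unfold transitionMatrix rowSum
  split_ifs
  · fun_prop
  · refine measurable_const.sub (Finset.measurable_sum _ fun e _ => ?_)
    split_ifs <;> fun_prop
  · fun_prop

/-- How far the visits of a pair of traces are from being invariant under the transition matrix of
two independent users with parameters `x` and `y`. -/
def pairDefect (x y : Param E o) (M : ℕ) (w : ℕ → Fin r × Fin r) (z : Fin r × Fin r) : ℝ :=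
  |∑ a, visits w M a * prodMatrix (userMatrix x) (userMatrix y) a z - visits w M z|

theorem measurable_pairDefect {n : ℕ} (u v : Fin n) (M : ℕ) (w : ℕ → Fin r × Fin r)
    (z : Fin r × Fin r) :
    Measurable fun q : Fin n → Param E o => pairDefect (q u) (q v) M w z := by
  have h : ∀ (u : Fin n) (i l : Fin r),
      Measurable fun q : Fin n → Param E o => userMatrix (q u) i l :=
    fun u i l => (measurable_transitionMatrix i l).comp (measurable_pi_apply u)
  unfold pairDefect
  simp only [← Real.norm_eq_abs]
  refine Measurable.norm (Measurable.sub_const (Finset.measurable_sum _ fun a _ => ?_) _)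
  exact (((h u _ _).mul (h v _ _))).const_mul _

/-- The traces `w` look like those of the group of the user `z`: the trace of each user of the group
conforms to its transition matrix and visits all states often, and associated users have dependent
traces. -/
def Passes {n : ℕ} (H : SimpleGraph (Fin n)) (z : Fin n) (q : Fin n → Param E o) (M : ℕ) (l b : ℝ)
    (w : Fin n → ℕ → Fin r) : Prop :=
  (∀ v, H.Reachable z v → Conforms (userMatrix (q v)) M l (w v) ∧ ∀ i, b < visits (w v) M i) ∧
  ∀ u v, H.Reachable z u → H.Adj u v →
    ∃ y, b ≤ pairDefect (q u) (q v) M (fun k => (w u k, w v k)) y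

/-- The tests read only times up to `M`, so the arbitrary continuation of the observations is
harmless. -/
theorem Passes.congr {n : ℕ} {H : SimpleGraph (Fin n)} {z : Fin n} {q : Fin n → Param E o} {M : ℕ}
    {l b : ℝ} {w w' : Fin n → ℕ → Fin r} (h : Passes H z q M l b w)
    (hw : ∀ v, ∀ k ≤ M, w v k = w' v k) : Passes H z q M l b w' := by
  have h1 : ∀ v, visits (w' v) M = visits (w v) M := fun v =>
    visits_congr fun k hk => (hw v k hk.le).symm
  have h2 : ∀ v, jumps (w' v) M = jumps (w v) M := fun v => jumps_congr fun k hk => (hw v k hk).symm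
  have h3 : ∀ u v, visits (fun k => (w' u k, w' v k)) M = visits (fun k => (w u k, w v k)) M :=
    fun u v => visits_congr fun k hk => by rw [hw u k hk.le, hw v k hk.le]
  unfold Passes Conforms pairDefect at *
  simp only [h1, h2, h3]
  exact h

theorem measurableSet_passes {n : ℕ} (H : SimpleGraph (Fin n)) (z : Fin n) (M : ℕ) (l b : ℝ)
    (w : Fin n → ℕ → Fin r) :
    MeasurableSet {q : Fin n → Param E o | Passes H z q M l b w} := by
  rw [measurableSet_setOfPred]
  unfold Passes Conforms
  refine Measurable.and (Measurable.forall fun v => Measurable.imp measurable_const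
    (Measurable.and (Measurable.forall fun y => Measurable.forall fun y' => ?_) measurable_const))
    (Measurable.forall fun u => Measurable.forall fun v => Measurable.imp measurable_const
    (Measurable.imp measurable_const (Measurable.exists fun y => ?_)))
  · rw [← measurableSet_setOfPred]
    refine measurableSet_lt ?_ measurable_const
    simp only [← Real.norm_eq_abs]
    exact (measurable_const.sub
      (((measurable_transitionMatrix y y').comp (measurable_pi_apply v)).mul_const _)).norm
  · rw [← measurableSet_setOfPred]
    exact measurableSet_le measurable_const (measurable_pairDefect u v M _ y)

/-- The observations, continued arbitrarily. -/
def extendObs (i₀ : Fin r) {m : ℕ} (Y : Fin m → Fin r) : ℕ → Fin r :=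
  fun k => if h : k < m then Y ⟨k, h⟩ else i₀

/-- The assignments of pseudonyms to users, together with the label of the first user, under which
the observations look like those of the group of that user. -/
def candidates (i₀ : Fin r) (m : ℕ) (β : ℝ) {n : ℕ} (H : SimpleGraph (Fin n))
    (q : Fin n → Param E o) (Y : Fin n → Fin m → Fin r) : Set (Equiv.Perm (Fin n) × Fin n) :=
  -- m samples contain m - 1 jumps. The tolerance exceeds the √M fluctuations by the factor n^β; the
  -- lower bound n^(-β)·M eventually drops below any fixed positive fraction of M.
  {c | c.2.val = 0 ∧ Passes H c.2 q (m - 1) ((n : ℝ) ^ β * √(m - 1 : ℕ))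
    ((n : ℝ) ^ (-β) * (m - 1 : ℕ)) fun v => extendObs i₀ (Y (c.1 v))}

open Classical in
/-- The sample at time `k` of the pseudonym that an arbitrary candidate gives to the first user. -/
noncomputable def readOff (i₀ : Fin r) {m n : ℕ} (W : Set (Equiv.Perm (Fin n) × Fin n))
    (Y : Fin n → Fin m → Fin r) (k : ℕ) : Fin r :=
  if h : W.Nonempty then extendObs i₀ (Y (h.some.1 h.some.2)) k else i₀

/-- The estimator that matches pseudonyms and users of the group of the first user. -/
noncomputable def groupEstimator (i₀ : Fin r) (m : ℕ → ℕ) (β : ℝ) : Estimator E o m :=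
  fun n H q Y k => readOff i₀ (candidates i₀ (m n) β H q Y) Y k

/-- Observations and candidate sets take finitely many values, and the arbitrary choice depends only
on the candidate set. So it suffices that passing is measurable in the parameters for fixed
observations. -/
theorem groupEstimator_isMeasurable (i₀ : Fin r) (m : ℕ → ℕ) (β : ℝ) :
    (groupEstimator i₀ m β : Estimator E o m).IsMeasurable := by
  intro n H k
  refine measurable_to_countable' fun i => ?_
  have : (fun z : (Fin n → Param E o) × (Fin n → Fin (m n) → Fin r) =>
      groupEstimator i₀ m β n H z.1 z.2 k) ⁻¹' {i}
      = ⋃ Y₀ : Fin n → Fin (m n) → Fin r, ⋃ W₀ : Set (Equiv.Perm (Fin n) × Fin n),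
        ⋃ (_ : readOff i₀ W₀ Y₀ k = i), {q | candidates i₀ (m n) β H q Y₀ = W₀} ×ˢ {Y₀} := by
    ext ⟨q, Y⟩
    simp only [groupEstimator, Set.mem_preimage, Set.mem_singleton_iff, Set.mem_iUnion, Set.mem_prod,
      Set.mem_ofPred_eq, exists_prop]
    constructor
    · exact fun h => ⟨Y, _, h, rfl, rfl⟩
    · rintro ⟨Y₀, W₀, h, h1, rfl⟩
      rw [h1, h]
  rw [this]
  refine MeasurableSet.iUnion fun Y₀ => MeasurableSet.iUnion fun W₀ => MeasurableSet.iUnion fun _ =>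
    MeasurableSet.prod ?_ (measurableSet_singleton _)
  have h2 : {q : Fin n → Param E o | candidates i₀ (m n) β H q Y₀ = W₀}
      = ⋂ c, {q | c ∈ candidates i₀ (m n) β H q Y₀ ↔ c ∈ W₀} := by
    ext q
    simp [Set.ext_iff]
  rw [h2]
  refine MeasurableSet.iInter fun c => ?_
  rw [measurableSet_setOfPred]
  refine Measurable.iff ?_ measurable_const
  unfold candidates
  exact Measurable.and measurable_const (measurableSet_setOfPred.1 (measurableSet_passes H c.2 _ _ _ _))

/-- The estimator is right if the true assignment is a candidate and all candidates agree with it at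
the first user. -/
theorem groupEstimator_eq {i₀ : Fin r} {m : ℕ → ℕ} {β : ℝ} {n : ℕ} {H : SimpleGraph (Fin n)}
    {q : Fin n → Param E o} {x : Traces r} {z : Fin n} (hz : z.val = 0) {k : ℕ} (hk : k < m n)
    (htrue : Passes H z q (m n - 1) ((n : ℝ) ^ β * √(m n - 1 : ℕ))
      ((n : ℝ) ^ (-β) * (m n - 1 : ℕ)) fun v => x v)
    (hfalse : ∀ τ : Equiv.Perm (Fin n), Passes H z q (m n - 1) ((n : ℝ) ^ β * √(m n - 1 : ℕ))
      ((n : ℝ) ^ (-β) * (m n - 1 : ℕ)) (fun v => x (τ v)) → τ z = z)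
    (π : Equiv.Perm (Fin n)) :
    groupEstimator i₀ m β n H q (anonymize (m n) π x) k = x 0 k := by
  have hobs : ∀ (c : Equiv.Perm (Fin n)) (v : Fin n), ∀ j < m n,
      extendObs i₀ (anonymize (m n) π x (c v)) j = x ((c.trans π.symm) v) j := fun c v j hj => by
    simp [extendObs, hj, anonymize]
  have hne : (candidates i₀ (m n) β H q (anonymize (m n) π x)).Nonempty :=
    ⟨(π, z), hz, htrue.congr fun v j hj => by
      rw [hobs _ _ _ (by omega)]; simp⟩
  rw [groupEstimator, readOff, dif_pos hne]
  obtain ⟨h0, hp⟩ := hne.some_mem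
  have hz' : hne.some.2 = z := Fin.ext (h0.trans hz.symm)
  rw [hz'] at hp
  rw [hobs _ _ _ hk, hz', hfalse (hne.some.1.trans π.symm)
    (hp.congr fun v j hj => hobs _ _ _ (by omega)), hz]

/-! ### Users that pass for the group of the first user -/

variable {G : SimpleGraph ℕ} {p : ℕ → Param E o} {x : Traces r} {n M : ℕ} {l b : ℝ}

/-- The same jump count is within `l` of both predictions; dividing by more than `b` visits compares
the matrices. -/
theorem abs_sub_le_of_conforms {S : Type*} [DecidableEq S] {T T' : S → S → ℝ} {w : ℕ → S}
    (hb : 0 < b) (h : Conforms T M l w) (h' : Conforms T' M l w) (hv : ∀ i, b < visits w M i)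
    (i j : S) : |T i j - T' i j| ≤ 2 * l / b := by
  have h1 := h i j
  have h2 := h' i j
  have h3 : |T i j - T' i j| * visits w M i ≤ 2 * l := by
    rw [← abs_of_nonneg (visits_nonneg w M i), ← abs_mul]
    have : (T i j - T' i j) * visits w M i = (jumps w M i j - T' i j * visits w M i)
      - (jumps w M i j - T i j * visits w M i) := by ring
    rw [this]
    exact (abs_sub _ _).trans (by linarith)
  rw [le_div_iff₀ hb]
  exact (mul_le_mul_of_nonneg_left (hv i).le (abs_nonneg _)).trans h3

/-- Pairs of users that conform to independence fail the test for dependence. -/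
theorem pairDefect_lt {q q' a a' : Param E o} (hq : q ∈ paramRegion E o)
    (ha' : a' ∈ paramRegion E o) {e : ℝ}
    (h : ∀ i j, |userMatrix a i j - userMatrix q i j| ≤ e)
    (h' : ∀ i j, |userMatrix a' i j - userMatrix q' i j| ≤ e) {w : ℕ → Fin r × Fin r}
    (hw : Conforms (prodMatrix (userMatrix a) (userMatrix a')) M l w)
    (hb : (r : ℝ) * r * l + 1 + 2 * e * M < b) (z : Fin r × Fin r) : pairDefect q q' M w z < b := by
  -- Near-invariance under the product of the actual matrices costs r²·l + 1; replacing these by the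
  -- matrices of `q` and `q'` costs 2·e per entry, hence 2·e·M over all visits.
  have h1 := abs_sum_visits_mul_sub_le (fun y z => (hw y z).le) z
  have h2 : ∀ y, |prodMatrix (userMatrix q) (userMatrix q') y z
      - prodMatrix (userMatrix a) (userMatrix a') y z| ≤ 2 * e := fun y => by
    simp only [prodMatrix]
    have h3 := h y.1 z.1
    have h4 := h' y.2 z.2
    have hr := userMatrix_mem_rowStochastic hq
    have hr' := userMatrix_mem_rowStochastic ha'
    rw [abs_sub_comm] at h3 h4
    have h5 : userMatrix q y.1 z.1 * userMatrix q' y.2 z.2 - userMatrix a y.1 z.1 * userMatrix a' y.2 z.2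
      = userMatrix q y.1 z.1 * (userMatrix q' y.2 z.2 - userMatrix a' y.2 z.2)
        + (userMatrix q y.1 z.1 - userMatrix a y.1 z.1) * userMatrix a' y.2 z.2 := by ring
    rw [h5, two_mul]
    refine (abs_add_le _ _).trans (add_le_add ?_ ?_)
    · rw [abs_mul, abs_of_nonneg (nonneg_of_mem_rowStochastic hr)]
      exact (mul_le_of_le_one_left (abs_nonneg _) (le_one_of_mem_rowStochastic hr)).trans h4
    · rw [abs_mul, abs_of_nonneg (nonneg_of_mem_rowStochastic hr')]
      exact (mul_le_of_le_one_right (abs_nonneg _) (le_one_of_mem_rowStochastic hr')).trans h3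
  have h3 : |∑ y, visits w M y * (prodMatrix (userMatrix q) (userMatrix q') y z
      - prodMatrix (userMatrix a) (userMatrix a') y z)| ≤ 2 * e * M := by
    refine (Finset.abs_sum_le_sum_abs _ _).trans ((Finset.sum_le_sum
      (g := fun y => visits w M y * (2 * e)) fun y _ => ?_).trans_eq ?_)
    · rw [abs_mul, abs_of_nonneg (visits_nonneg w M y)]
      exact mul_le_mul_of_nonneg_left (h2 y) (visits_nonneg w M y)
    · rw [← Finset.sum_mul, sum_visits]; ring
  have h4 : ∑ y, visits w M y * prodMatrix (userMatrix q) (userMatrix q') y z - visits w M z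
      = (∑ y, visits w M y * prodMatrix (userMatrix a) (userMatrix a') y z - visits w M z)
      + ∑ y, visits w M y * (prodMatrix (userMatrix q) (userMatrix q') y z
      - prodMatrix (userMatrix a) (userMatrix a') y z) := by
    simp only [mul_sub, Finset.sum_sub_distrib]; ring
  rw [pairDefect, h4]
  simp only [Fintype.card_prod, Fintype.card_fin, Nat.cast_mul] at h1
  exact (abs_add_le _ _).trans_lt (by linarith)

/-- All users conform to their transition matrices, and all pairs from different groups conform to
independence. -/
def AllConform (G : SimpleGraph ℕ) (p : ℕ → Param E o) (n M : ℕ) (l : ℝ) (x : Traces r) : Prop :=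
  (∀ u : Fin n, Conforms (userMatrix (p u)) M l (x u)) ∧
  ∀ u v : Fin n, ¬ G.Reachable u v →
    Conforms (prodMatrix (userMatrix (p u)) (userMatrix (p v))) M l (pairTrace x u v)

theorem Passes.param_close (hx : AllConform G p n M l x) (hb : 0 < b) {z : Fin n}
    {τ : Fin n → Fin n} {H : SimpleGraph (Fin n)}
    (hP : Passes H z (fun u => p u) M l b fun v => x (τ v)) {v : Fin n} (hv : H.Reachable z v)
    (i j : Fin r) : |userMatrix (p (τ v)) i j - userMatrix (p v) i j| ≤ 2 * l / b :=
  abs_sub_le_of_conforms (T := userMatrix (p (τ v))) (T' := userMatrix (p v)) hb (hx.1 (τ v))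
    (hP.1 v hv).1 (hP.1 v hv).2 i j

/-- Traces that pass for a group stem from the users of a single group. -/
theorem Passes.reachable (hp : ∀ u, p u ∈ paramRegion E o) (hx : AllConform G p n M l x) (hb : 0 < b)
    (hlb : (r : ℝ) * r * l + 1 + 2 * (2 * l / b) * M < b) {z : Fin n} {τ : Fin n → Fin n}
    {H : SimpleGraph (Fin n)}
    (hP : Passes H z (fun u => p u) M l b fun v => x (τ v)) {v : Fin n} (hv : H.Reachable z v) :
    G.Reachable (τ z) (τ v) := by
  -- If the images of an edge lay in different groups, their traces would conform to independence
  -- and fail the dependence test. Walks extend this from edges to the component.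
  have hadj : ∀ u v, H.Reachable z u → H.Adj u v → G.Reachable (τ u) (τ v) := fun u v hu huv => by
    by_contra hcon
    obtain ⟨y, hy⟩ := hP.2 u v hu huv
    exact absurd hy (not_le.2 (pairDefect_lt (hp _) (hp _) (hP.param_close hx hb hu)
      (hP.param_close hx hb (hu.trans huv.reachable)) (hx.2 _ _ hcon) hlb y))
  have hv' := hv
  rw [SimpleGraph.reachable_iff_reflTransGen] at hv
  induction hv with
  | refl => exact SimpleGraph.Reachable.refl _
  | tail h1 h2 ih =>
    have h1' := (SimpleGraph.reachable_iff_reflTransGen _ _).2 h1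
    exact (ih h1').trans (hadj _ _ h1' h2)

/-- Restriction to the first `n` users could disconnect a group, but not when it keeps the whole
group. -/
theorem firstUsers_reachable {n : ℕ} {u v : Fin n}
    (hC : ∀ w, G.Reachable u w → w < n) (h : G.Reachable u v) : (firstUsers G n).Reachable u v := by
  have key : ∀ w, (hw : G.Reachable u w) → (firstUsers G n).Reachable u ⟨w, hC w hw⟩ := fun w hw => by
    have hw' := (SimpleGraph.reachable_iff_reflTransGen _ _).1 hw
    induction hw' with
    | refl => exact SimpleGraph.Reachable.refl _
    | tail h1 h2 ih =>
      have h1' := (SimpleGraph.reachable_iff_reflTransGen _ _).2 h1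
      refine (ih h1').trans (SimpleGraph.Adj.reachable ?_)
      exact h2
  exact key v h

theorem reachable_of_firstUsers {n : ℕ} {u v : Fin n} (h : (firstUsers G n).Reachable u v) :
    G.Reachable u v :=
  h.map (SimpleGraph.Hom.comap Fin.val G)

end EstimatorConstruction

/-! ### Users with nearly equal parameters -/

section Collisions

variable {r : ℕ} {E : Finset (Fin r × Fin r)} {o : Fin r → Fin r} {f : Param E o → ℝ≥0∞}

theorem IsParamDensity.isProbabilityMeasure (hf : IsParamDensity f) :
    IsProbabilityMeasure (volume.withDensity f) :=
  ⟨by rw [withDensity_apply _ MeasurableSet.univ, Measure.restrict_univ, hf.lintegral_eq_one]⟩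

theorem IsParamDensity.isProbabilityMeasure_populationLaw (hf : IsParamDensity f) :
    IsProbabilityMeasure (populationLaw f) := by
  have := hf.isProbabilityMeasure
  unfold populationLaw
  infer_instance

/-- Balls of the sup metric are cubes of side 2·e. -/
theorem withDensity_closedBall_le {δ : ℝ≥0} (hδ : ∀ x, f x ≤ δ) (a : Param E o) {e : ℝ}
    (he : 0 ≤ e) : volume.withDensity f (Metric.closedBall a e)
      ≤ ENNReal.ofReal (δ * (2 * e) ^ Fintype.card (FreeEdge E o)) := by
  rw [withDensity_apply _ Metric.isClosed_closedBall.measurableSet]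
  calc ∫⁻ x in Metric.closedBall a e, f x ≤ ∫⁻ x in Metric.closedBall a e, (δ : ℝ≥0∞) :=
        lintegral_mono fun x => hδ x
    _ = _ := by
        rw [setLIntegral_const, Real.volume_pi_closedBall a he, ENNReal.ofReal_mul (NNReal.coe_nonneg δ),
          ENNReal.ofReal_coe_nnreal]

theorem map_populationLaw_comp (hf : IsParamDensity f) {κ : Type*} [Fintype κ] {g : κ → ℕ}
    (hg : Function.Injective g) :
    (populationLaw f).map (fun p j => p (g j)) = Measure.pi fun _ : κ => volume.withDensity f := by
  have := hf.isProbabilityMeasure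
  have := hf.isProbabilityMeasure_populationLaw
  have hind : iIndepFun (fun (i : ℕ) (p : ℕ → Param E o) => p i) (populationLaw f) :=
    iIndepFun_infinitePi (P := fun _ : ℕ => volume.withDensity f) (X := fun _ x => x)
      fun _ => measurable_id
  have h := (iIndepFun_iff_map_fun_eq_pi_map fun j =>
    (measurable_pi_apply (g j)).aemeasurable).1 (hind.precomp hg)
  rw [h]
  congr 1
  funext j
  exact Measure.infinitePi_map_eval (fun _ : ℕ => volume.withDensity f) (g j)

/-- Several users whose parameters nearly equal those of as many other users are improbable. -/
theorem populationLaw_close_le (hf : IsParamDensity f) {δ : ℝ≥0} (hδ : ∀ x, f x ≤ δ) {ι : Type*}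
    [Fintype ι] {σ τ : ι → ℕ} (hστ : Function.Injective (Sum.elim σ τ)) {e : ℝ} (he : 0 ≤ e) :
    populationLaw f {p | ∀ i, dist (p (τ i)) (p (σ i)) ≤ e}
      ≤ ENNReal.ofReal ((δ * (2 * e) ^ Fintype.card (FreeEdge E o)) ^ Fintype.card ι) := by
  have := hf.isProbabilityMeasure
  let ν : Measure (Param E o) := volume.withDensity f
  let D : Set ((ι → Param E o) × (ι → Param E o)) := {q | ∀ i, dist (q.2 i) (q.1 i) ≤ e}
  have hD : MeasurableSet D := by
    simp only [D, Set.ofPred_forall]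
    refine MeasurableSet.iInter fun i => measurableSet_le (Measurable.dist ?_ ?_) measurable_const <;>
      fun_prop
  have hmp := measurePreserving_sumPiEquivProdPi (fun _ : ι ⊕ ι => ν)
  have hm : Measurable fun (p : ℕ → Param E o) (j : ι ⊕ ι) => p (Sum.elim σ τ j) := by fun_prop
  calc populationLaw f {p | ∀ i, dist (p (τ i)) (p (σ i)) ≤ e}
      = (populationLaw f).map (fun p j => p (Sum.elim σ τ j))
          (MeasurableEquiv.sumPiEquivProdPi (fun _ : ι ⊕ ι => Param E o) ⁻¹' D) := by
        rw [Measure.map_apply hm (hmp.measurable hD)]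
        rfl
    _ = (Measure.pi fun _ : ι => ν).prod (Measure.pi fun _ : ι => ν) D := by
        rw [map_populationLaw_comp hf hστ]
        exact hmp.measure_preimage hD.nullMeasurableSet
    _ = ∫⁻ a, (Measure.pi fun _ : ι => ν) (Prod.mk a ⁻¹' D) ∂(Measure.pi fun _ : ι => ν) :=
        Measure.prod_apply hD
    _ ≤ ∫⁻ _, ENNReal.ofReal ((δ * (2 * e) ^ Fintype.card (FreeEdge E o)) ^ Fintype.card ι)
          ∂(Measure.pi fun _ : ι => ν) := by
        refine lintegral_mono fun a => ?_
        -- With the parameters `a` of the users `σ i` fixed, those of the users `τ i` must fall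
        -- independently into the balls around them.
        have hs : Prod.mk a ⁻¹' D = Set.univ.pi fun i => Metric.closedBall (a i) e := by
          ext b; simp [D]
        rw [hs, Measure.pi_pi, ENNReal.ofReal_pow (by positivity)]
        refine (Finset.prod_le_prod' fun i _ => withDensity_closedBall_le hδ (a i) he).trans_eq ?_
        simp
    _ = _ := by simp

/-- Other users may pass for the group of the user `0`: some user of that group nearly agrees with
the user `0`, or the group nearly agrees with users of another group. -/
def collisions (G : SimpleGraph ℕ) (n : ℕ) (e : ℝ) : Set (ℕ → Param E o) :=
  (⋃ u ∈ (G.connectedComponentMk 0).supp, ⋃ (_ : u ≠ 0), {p | dist (p u) (p 0) ≤ e}) ∪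
  ⋃ u ∈ Finset.range n, ⋃ τ : (G.connectedComponentMk 0).supp → ℕ,
    ⋃ (_ : Function.Injective τ ∧ ¬ G.Reachable 0 u ∧ ∀ v, τ v < n ∧ G.Reachable u (τ v)),
      {p | ∀ v : (G.connectedComponentMk 0).supp, dist (p (τ v)) (p v) ≤ e}

/-- Union bound. Inside the group there are at most s partners for user `0`, each costing one ball.
Outside, there are n choices of `u` and at most N^s maps into its group, each costing s independent
balls; confinement to one group avoids n^s choices. -/
theorem populationLaw_collisions_le (hf : IsParamDensity f) {δ : ℝ≥0} (hδ : ∀ x, f x ≤ δ)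
    {G : SimpleGraph ℕ} (hG : ∀ C : G.ConnectedComponent, C.supp.Finite) {n : ℕ} {e N : ℝ}
    (he : 0 ≤ e) (hN : ∀ C : G.ConnectedComponent, ((C.supp ∩ Set.Iio n).ncard : ℝ) ≤ N) {s : ℕ}
    (hs : (G.connectedComponentMk 0).supp.ncard = s) :
    populationLaw f (collisions G n e)
      ≤ ENNReal.ofReal (s * (δ * (2 * e) ^ Fintype.card (FreeEdge E o)))
        + ENNReal.ofReal (n * (N ^ s * (δ * (2 * e) ^ Fintype.card (FreeEdge E o)) ^ s)) := by
  classical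
  set C₀ := G.connectedComponentMk 0 with hC₀
  have : Fintype C₀.supp := (hG C₀).fintype
  have hcard : Fintype.card C₀.supp = s := by
    rw [← hs, Set.ncard_eq_toFinset_card', Set.toFinset_card]
  set D : ℝ := δ * (2 * e) ^ Fintype.card (FreeEdge E o) with hD
  have hN0 : 0 ≤ N := (Nat.cast_nonneg _).trans (hN C₀)
  refine (measure_union_le _ _).trans (add_le_add ?_ ?_)
  · rw [← (hG C₀).coe_toFinset]
    simp only [Finset.mem_coe]
    refine (measure_biUnion_finset_le _ _).trans ?_
    calc ∑ u ∈ (hG C₀).toFinset, populationLaw f (⋃ (_ : u ≠ 0), {p | dist (p u) (p 0) ≤ e})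
        ≤ ∑ u ∈ (hG C₀).toFinset, ENNReal.ofReal D := by
          refine Finset.sum_le_sum fun u _ => ?_
          by_cases hu : u = 0
          · simp [hu]
          · have h := populationLaw_close_le hf hδ (ι := Unit) (σ := fun _ => 0) (τ := fun _ => u)
              (fun a b hab => by
                rcases a with _ | _ <;> rcases b with _ | _ <;> simp_all [eq_comm]) he
            simpa [hu, hD] using h
      _ = ENNReal.ofReal (s * D) := by
          rw [Finset.sum_const, ← Set.ncard_eq_toFinset_card _ (hG C₀), hs, nsmul_eq_mul,
            ENNReal.ofReal_mul (Nat.cast_nonneg _), ENNReal.ofReal_natCast]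
  · refine (measure_biUnion_finset_le _ _).trans ?_
    have hfin : ∀ u, ((G.connectedComponentMk u).supp ∩ Set.Iio n).Finite := fun u =>
      (Set.finite_Iio n).inter_of_right _
    have hbd : ∀ u ∈ Finset.range n, populationLaw f (⋃ τ : C₀.supp → ℕ,
        ⋃ (_ : Function.Injective τ ∧ ¬ G.Reachable 0 u ∧ ∀ v, τ v < n ∧ G.Reachable u (τ v)),
        {p | ∀ v : C₀.supp, dist (p (τ v)) (p v) ≤ e}) ≤ ENNReal.ofReal (N ^ s * D ^ s) := by
      intro u _
      have hsub : (⋃ τ : C₀.supp → ℕ,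
          ⋃ (_ : Function.Injective τ ∧ ¬ G.Reachable 0 u ∧ ∀ v, τ v < n ∧ G.Reachable u (τ v)),
          {p : ℕ → Param E o | ∀ v : C₀.supp, dist (p (τ v)) (p v) ≤ e})
          ⊆ ⋃ τ ∈ Fintype.piFinset fun _ : C₀.supp => (hfin u).toFinset,
          ⋃ (_ : Function.Injective τ ∧ ¬ G.Reachable 0 u ∧ ∀ v, τ v < n ∧ G.Reachable u (τ v)),
          {p : ℕ → Param E o | ∀ v : C₀.supp, dist (p (τ v)) (p v) ≤ e} := by
        refine Set.iUnion_mono fun τ => Set.iUnion_subset fun hτ => ?_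
        refine Set.subset_iUnion₂_of_subset ?_ hτ subset_rfl
        rw [Fintype.mem_piFinset]
        intro v
        rw [Set.Finite.mem_toFinset]
        exact ⟨SimpleGraph.ConnectedComponent.sound (hτ.2.2 v).2.symm, (hτ.2.2 v).1⟩
      refine (measure_mono hsub).trans ((measure_biUnion_finset_le _ _).trans ?_)
      calc _ ≤ ∑ τ ∈ Fintype.piFinset fun _ : C₀.supp => (hfin u).toFinset,
            ENNReal.ofReal (D ^ s) := by
            refine Finset.sum_le_sum fun τ _ => ?_
            by_cases hτ : Function.Injective τ ∧ ¬ G.Reachable 0 u ∧ ∀ v, τ v < n ∧ G.Reachable u (τ v)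
            · have hne : ∀ a b : C₀.supp, (a : ℕ) ≠ τ b := fun a b hab => by
                have ha : G.Reachable (a : ℕ) 0 := SimpleGraph.ConnectedComponent.exact a.2
                rw [hab] at ha
                exact hτ.2.1 (((hτ.2.2 b).2.trans ha).symm)
              have h := populationLaw_close_le hf hδ (σ := fun v : C₀.supp => (v : ℕ)) (τ := τ)
                (Function.Injective.sumElim Subtype.val_injective hτ.1 hne) he
              rw [hcard] at h
              simpa [hτ, hD] using h
            · simp only [hτ, Set.iUnion_false, measure_empty, zero_le]
        _ ≤ ENNReal.ofReal (N ^ s * D ^ s) := by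
            rw [Finset.sum_const, Fintype.card_piFinset, Finset.prod_const, Finset.card_univ, hcard,
              nsmul_eq_mul, ← Set.ncard_eq_toFinset_card _ (hfin u), ← ENNReal.ofReal_natCast,
              ← ENNReal.ofReal_mul (Nat.cast_nonneg _)]
            refine ENNReal.ofReal_le_ofReal (mul_le_mul_of_nonneg_right ?_ (by positivity))
            push_cast
            exact pow_le_pow_left₀ (Nat.cast_nonneg _) (hN _) _
    refine (Finset.sum_le_sum hbd).trans_eq ?_
    rw [Finset.sum_const, Finset.card_range, nsmul_eq_mul, ENNReal.ofReal_mul (Nat.cast_nonneg n),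
      ENNReal.ofReal_natCast]

theorem ae_mem_paramRegion (hf : IsParamDensity f) :
    ∀ᵐ p ∂(populationLaw f), ∀ u, p u ∈ paramRegion E o := by
  have := hf.isProbabilityMeasure
  rw [ae_all_iff]
  intro u
  have h : ∀ᵐ x ∂(volume.withDensity f), x ∈ paramRegion E o := by
    rw [ae_withDensity_iff hf.measurable]
    exact Eventually.of_forall fun x hx => by_contra fun h => hx (hf.eq_zero x h)
  exact (measurePreserving_eval_infinitePi (fun _ : ℕ => volume.withDensity f) u).quasiMeasurePreserving.ae h

end Collisions

/-! ### Asymptotics of the sample size -/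

section Asymptotics

variable {m : ℕ → ℕ} {c κ : ℝ}

theorem tendsto_natCast_rpow {a : ℝ} (ha : 0 < a) : Tendsto (fun n : ℕ => (n : ℝ) ^ a) atTop atTop :=
  (tendsto_rpow_atTop ha).comp tendsto_natCast_atTop_atTop

theorem tendsto_natCast_rpow_neg {a : ℝ} (ha : a < 0) :
    Tendsto (fun n : ℕ => (n : ℝ) ^ a) atTop (𝓝 0) := by
  have := (tendsto_rpow_neg_atTop (neg_pos.2 ha)).comp (tendsto_natCast_atTop_atTop (R := ℝ))
  simpa [Function.comp_def] using this

theorem eventually_le_sampleSize (hc : 0 < c) (hκ : 0 < κ)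
    (hm : ∀ n : ℕ, |(m n : ℝ) - c * (n : ℝ) ^ κ| < 1) :
    ∀ᶠ n : ℕ in atTop, c / 2 * (n : ℝ) ^ κ ≤ (m n - 1 : ℕ) := by
  filter_upwards [(tendsto_natCast_rpow hκ).eventually_ge_atTop (4 / c)] with n hn
  have h1 : 4 ≤ c * (n : ℝ) ^ κ := by rwa [div_le_iff₀' hc] at hn
  have h2 := (abs_lt.1 (hm n)).1
  have h3 : (m n : ℝ) ≤ (m n - 1 : ℕ) + 1 := by exact_mod_cast (by omega : m n ≤ m n - 1 + 1)
  linarith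

theorem tendsto_sampleSize (hc : 0 < c) (hκ : 0 < κ)
    (hm : ∀ n : ℕ, |(m n : ℝ) - c * (n : ℝ) ^ κ| < 1) :
    Tendsto (fun n => m n - 1) atTop atTop := by
  rw [← tendsto_natCast_atTop_iff (R := ℝ)]
  exact tendsto_atTop_mono' _ (eventually_le_sampleSize hc hκ hm)
    ((tendsto_natCast_rpow hκ).const_mul_atTop (half_pos hc))

theorem eventually_rpow_le_sqrt_sampleSize (hc : 0 < c) (hκ : 0 < κ)
    (hm : ∀ n : ℕ, |(m n : ℝ) - c * (n : ℝ) ^ κ| < 1) :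
    ∀ᶠ n : ℕ in atTop, √(c / 2) * (n : ℝ) ^ (κ / 2) ≤ √(m n - 1 : ℕ) := by
  filter_upwards [eventually_le_sampleSize hc hκ hm] with n hn
  refine Real.le_sqrt_of_sq_le ?_
  rw [mul_pow, Real.sq_sqrt (by positivity), ← Real.rpow_natCast, ← Real.rpow_mul (by positivity)]
  simpa using hn

/-- With y = n^β and q = √M the claim is a·y·q + 1 + 4·y²·q < q²/y. It follows from (a + 5)·y³ < q,
hence the condition 3β < κ/2. -/
theorem eventually_threshold_lt (hc : 0 < c) (hκ : 0 < κ)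
    (hm : ∀ n : ℕ, |(m n : ℝ) - c * (n : ℝ) ^ κ| < 1) {β : ℝ} (hβ : 0 < β) (hβκ : 3 * β < κ / 2)
    (a : ℝ) (ha : 0 ≤ a) :
    ∀ᶠ n : ℕ in atTop, a * ((n : ℝ) ^ β * √(m n - 1 : ℕ)) + 1
      + 2 * (2 * ((n : ℝ) ^ β * √(m n - 1 : ℕ)) / ((n : ℝ) ^ (-β) * (m n - 1 : ℕ))) * (m n - 1 : ℕ)
      < (n : ℝ) ^ (-β) * (m n - 1 : ℕ) := by
  have hsc : 0 < √(c / 2) := Real.sqrt_pos.2 (half_pos hc)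
  filter_upwards [eventually_rpow_le_sqrt_sampleSize hc hκ hm, eventually_ge_atTop 1,
    (tendsto_sampleSize hc hκ hm).eventually_ge_atTop 1,
    (tendsto_natCast_rpow (sub_pos.2 hβκ)).eventually_gt_atTop ((a + 5) / √(c / 2))]
    with n h1 hn hM h2
  set M : ℝ := ((m n - 1 : ℕ) : ℝ) with hMdef
  have hM1 : 1 ≤ M := by rw [hMdef]; exact_mod_cast hM
  have hn1 : (1 : ℝ) ≤ n := by exact_mod_cast hn
  have hn0 : (0 : ℝ) < n := by linarith
  set y := (n : ℝ) ^ β with hy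
  have hy1 : 1 ≤ y := Real.one_le_rpow hn1 hβ.le
  have hyn : (n : ℝ) ^ (-β) = y⁻¹ := Real.rpow_neg hn0.le β
  set q := √M with hq
  have hq1 : 1 ≤ q := Real.one_le_sqrt.2 hM1
  have hqM : q * q = M := Real.mul_self_sqrt (by linarith)
  have hkey : (a + 5) * y ^ 3 < q := by
    rw [div_lt_iff₀ hsc] at h2
    have h3 : (n : ℝ) ^ (κ / 2 - 3 * β) * y ^ 3 = (n : ℝ) ^ (κ / 2) := by
      rw [hy, ← Real.rpow_natCast, ← Real.rpow_mul hn0.le, ← Real.rpow_add hn0]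
      congr 1; push_cast; ring
    have h4 : (a + 5) * y ^ 3 < (n : ℝ) ^ (κ / 2 - 3 * β) * √(c / 2) * y ^ 3 :=
      mul_lt_mul_of_pos_right h2 (by positivity)
    calc (a + 5) * y ^ 3 < (n : ℝ) ^ (κ / 2 - 3 * β) * √(c / 2) * y ^ 3 := h4
      _ = √(c / 2) * (n : ℝ) ^ (κ / 2) := by rw [← h3]; ring
      _ ≤ q := h1
  rw [hyn]
  have h5 : 2 * (2 * (y * q) / (y⁻¹ * M)) * M = 4 * y ^ 2 * q := by
    rw [← hqM]; field_simp; ring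
  rw [h5, ← hqM, inv_mul_eq_div, lt_div_iff₀ (by linarith)]
  have h6 : (a * (y * q) + 1 + 4 * y ^ 2 * q) * y ≤ (a + 5) * y ^ 3 * q := by
    have h7 : 1 ≤ y ^ 2 * q := by nlinarith
    have h8 : a * (y * q) ≤ a * (y ^ 2 * q) := by
      refine mul_le_mul_of_nonneg_left (mul_le_mul_of_nonneg_right ?_ (by linarith)) ha
      nlinarith
    calc (a * (y * q) + 1 + 4 * y ^ 2 * q) * y ≤ (a * (y ^ 2 * q) + y ^ 2 * q + 4 * y ^ 2 * q) * y :=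
          mul_le_mul_of_nonneg_right (by linarith) (by linarith)
      _ = (a + 5) * y ^ 3 * q := by ring
  exact h6.trans_lt (mul_lt_mul_of_pos_right hkey (by linarith))

/-- The precision 2l/b of the parameter comparison equals 2·n^(2β)/√M. -/
theorem eventually_precision_le (hc : 0 < c) (hκ : 0 < κ)
    (hm : ∀ n : ℕ, |(m n : ℝ) - c * (n : ℝ) ^ κ| < 1) (β : ℝ) :
    ∀ᶠ n : ℕ in atTop, 2 * ((n : ℝ) ^ β * √(m n - 1 : ℕ)) / ((n : ℝ) ^ (-β) * (m n - 1 : ℕ))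
      ≤ 2 / √(c / 2) * (n : ℝ) ^ (2 * β - κ / 2) := by
  have hsc : 0 < √(c / 2) := Real.sqrt_pos.2 (half_pos hc)
  filter_upwards [eventually_rpow_le_sqrt_sampleSize hc hκ hm, eventually_ge_atTop 1,
    (tendsto_sampleSize hc hκ hm).eventually_ge_atTop 1] with n h1 hn hM
  set M : ℝ := ((m n - 1 : ℕ) : ℝ) with hMdef
  have hM1 : 1 ≤ M := by rw [hMdef]; exact_mod_cast hM
  have hn0 : (0 : ℝ) < n := by exact_mod_cast hn
  set q := √M with hq
  have hq0 : 0 < q := Real.sqrt_pos.2 (by linarith)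
  have hqM : q * q = M := Real.mul_self_sqrt (by linarith)
  have hy0 : 0 < (n : ℝ) ^ β := Real.rpow_pos_of_pos hn0 _
  have h2 : 2 * ((n : ℝ) ^ β * q) / ((n : ℝ) ^ (-β) * M) = 2 * (n : ℝ) ^ (2 * β) / q := by
    rw [Real.rpow_neg hn0.le, two_mul β, Real.rpow_add hn0, ← hqM]
    field_simp
  rw [h2, Real.rpow_sub hn0, div_mul_div_comm]
  exact div_le_div_of_nonneg_left (by positivity) (by positivity) h1

/-- Deviation bounds of order exp(1 - n^β) survive union bounds over polynomially many events. -/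
theorem tendsto_rpow_mul_exp_neg_rpow (j : ℝ) {β : ℝ} (hβ : 0 < β) :
    Tendsto (fun n : ℕ => (n : ℝ) ^ j * Real.exp (1 - (n : ℝ) ^ β)) atTop (𝓝 0) := by
  have h := ((tendsto_rpow_mul_exp_neg_mul_atTop_nhds_zero (j / β) 1 one_pos).comp
    (tendsto_natCast_rpow hβ)).const_mul (Real.exp 1)
  rw [mul_zero] at h
  refine h.congr fun n => ?_
  rw [Function.comp_apply, ← Real.rpow_mul (Nat.cast_nonneg n), mul_div_cancel₀ _ hβ.ne',
    mul_left_comm, ← Real.exp_add]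
  ring_nf

end Asymptotics

/-! ### The true assignment passes, and false ones require collisions -/

section Convergence

open Matrix

variable {r : ℕ} {E : Finset (Fin r × Fin r)} {o : Fin r → Fin r} {G : SimpleGraph ℕ}
  {p : ℕ → Param E o} {ρ : Measure (Traces r)}

/-- Choosing t = 1/√M makes the exponent 1 - a; then a union bound runs over n users and at most n²
pairs. -/
theorem IsDataLaw.measure_not_allConform_le [IsProbabilityMeasure ρ] (hρ : IsDataLaw G p ρ)
    (hp : ∀ u, p u ∈ paramRegion E o) (n : ℕ) {M : ℕ} (hM : 1 ≤ M) (a : ℝ) :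
    ρ {x | ¬ AllConform G p n M (a * √M) x}
      ≤ ENNReal.ofReal (n * (2 * r ^ 2 * Real.exp (1 - a)))
        + ENNReal.ofReal (n * n * (2 * (r * r) ^ 2 * Real.exp (1 - a))) := by
  have hM0 : (0 : ℝ) < M := by exact_mod_cast hM
  have hq0 : 0 < √(M : ℝ) := Real.sqrt_pos.2 hM0
  have ht0 : 0 ≤ 1 / √(M : ℝ) := by positivity
  have ht1 : 1 / √(M : ℝ) ≤ 1 := by
    rw [div_le_one hq0, Real.one_le_sqrt]
    exact_mod_cast hM
  have hexp : M * (1 / √(M : ℝ)) ^ 2 - 1 / √(M : ℝ) * (a * √M) = 1 - a := by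
    rw [div_pow, Real.sq_sqrt hM0.le]
    field_simp
  have hsub : {x | ¬ AllConform G p n M (a * √M) x}
      ⊆ (⋃ u : Fin n, {x : Traces r | ¬ Conforms (userMatrix (p u)) M (a * √M) (x u)})
        ∪ ⋃ q : Fin n × Fin n, {x : Traces r | ¬ G.Reachable q.1 q.2 ∧
          ¬ Conforms (prodMatrix (userMatrix (p q.1)) (userMatrix (p q.2))) M (a * √M)
            (pairTrace x q.1 q.2)} := by
    intro x hx
    rw [Set.mem_ofPred_eq, AllConform, not_and_or] at hx
    rcases hx with hx | hx
    · exact Or.inl (Set.mem_iUnion.2 (not_forall.1 hx))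
    · push Not at hx
      obtain ⟨u, v, h⟩ := hx
      exact Or.inr (Set.mem_iUnion.2 ⟨(u, v), h⟩)
  refine (measure_mono hsub).trans ((measure_union_le _ _).trans (add_le_add ?_ ?_))
  · refine (measure_iUnion_fintype_le _ _).trans ((Finset.sum_le_sum
      (g := fun _ => ENNReal.ofReal (2 * r ^ 2 * Real.exp (1 - a))) fun u _ => ?_).trans_eq ?_)
    · have hm : Measurable fun x : Traces r => x u := measurable_pi_apply _
      have := Measure.isProbabilityMeasure_map (μ := ρ) hm.aemeasurable
      have h := measure_not_conforms_le (T := userMatrix (p u)) (hρ.user_markov u)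
        (userMatrix_mem_rowStochastic (hp u)) ht0 ht1 M (a * √M)
      rw [hexp, Fintype.card_fin] at h
      exact (Measure.le_map_apply hm.aemeasurable _).trans h
    · rw [Finset.sum_const, Finset.card_univ, Fintype.card_fin, nsmul_eq_mul,
        ENNReal.ofReal_mul (Nat.cast_nonneg n), ENNReal.ofReal_natCast]
  · refine (measure_iUnion_fintype_le _ _).trans ((Finset.sum_le_sum
      (g := fun _ => ENNReal.ofReal (2 * (r * r) ^ 2 * Real.exp (1 - a))) fun q _ => ?_).trans_eq ?_)
    · by_cases hq : G.Reachable q.1 q.2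
      · simp [hq]
      have hm := measurable_pairTrace (r := r) q.1 q.2
      have := Measure.isProbabilityMeasure_map (μ := ρ) hm.aemeasurable
      have h := measure_not_conforms_le (hρ.pair_markov (hp q.1) hq)
        (prodMatrix_mem_rowStochastic (userMatrix_mem_rowStochastic (hp q.1))
        (userMatrix_mem_rowStochastic (hp q.2))) ht0 ht1 M (a * √M)
      rw [hexp, Fintype.card_prod, Fintype.card_fin, Nat.cast_mul] at h
      simp only [hq, not_false_eq_true, true_and]
      exact (Measure.le_map_apply hm.aemeasurable _).trans h
    · rw [Finset.sum_const, Finset.card_univ, Fintype.card_prod, Fintype.card_fin, nsmul_eq_mul,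
        ENNReal.ofReal_mul (p := (n : ℝ) * n) (by positivity), ← ENNReal.ofReal_natCast, Nat.cast_mul]

/-- With probability tending to `1`, all users conform and the group of the user `0` passes. -/
theorem IsDataLaw.tendsto_measure_not_passes [IsProbabilityMeasure ρ] (hρ : IsDataLaw G p ρ)
    (h_irr : IrreducibleOn (fun i l => (i, l) ∈ E) Set.univ)
    (h_aper : AperiodicOn (fun i l => (i, l) ∈ E) Set.univ)
    (ho : ∀ i, (i, o i) ∈ E) (i₀ : Fin r) (hp : ∀ u, p u ∈ paramRegion E o)
    (hfin : (G.connectedComponentMk 0).supp.Finite) {M : ℕ → ℕ} (hM : Tendsto M atTop atTop)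
    {β : ℝ} (hβ : 0 < β) :
    Tendsto (fun n : ℕ => ρ {x | ¬ (AllConform G p n (M n) ((n : ℝ) ^ β * √(M n)) x ∧
      ∀ z : Fin n, z.val = 0 → Passes (firstUsers G n) z (fun u => p u) (M n)
        ((n : ℝ) ^ β * √(M n)) ((n : ℝ) ^ (-β) * M n) fun v => x v)}) atTop (𝓝 0) := by
  classical
  -- The ergodic lower bounds `η` depend on `p` and on the users, but n^(-β) eventually falls below
  -- each of them.
  have hsmall : ∀ η > 0, ∀ᶠ n : ℕ in atTop, (n : ℝ) ^ (-β) ≤ η := fun η hη =>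
    (tendsto_natCast_rpow_neg (neg_neg_of_pos hβ)).eventually_le_const hη
  have hvis : ∀ v, Tendsto (fun n : ℕ =>
      ρ {x | ∃ i, visits (x v) (M n) i ≤ (n : ℝ) ^ (-β) * M n}) atTop (𝓝 0) := fun v => by
    obtain ⟨η, hη, h⟩ := hρ.exists_tendsto_visits h_irr h_aper ho i₀ (hp v)
    refine tendsto_of_tendsto_of_tendsto_of_le_of_le' tendsto_const_nhds (h.comp hM)
      (Eventually.of_forall fun _ => zero_le) ?_
    filter_upwards [hsmall η hη] with n hn
    refine measure_mono ?_
    rintro x ⟨i, hi⟩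
    exact ⟨i, hi.trans (mul_le_mul_of_nonneg_right hn (Nat.cast_nonneg _))⟩
  have hdef : ∀ u ∈ hfin.toFinset, ∀ v, Tendsto (fun n : ℕ =>
      ρ {x | G.Adj u v ∧ ∀ z, pairDefect (p u) (p v) (M n) (pairTrace x u v) z
        < (n : ℝ) ^ (-β) * M n}) atTop (𝓝 0) := fun u hu v => by
    by_cases huv : G.Adj u v
    · have hcomp : G.connectedComponentMk u = G.connectedComponentMk 0 := by simpa using hu
      obtain ⟨η, hη, h⟩ := hρ.exists_tendsto_defect h_irr h_aper ho i₀ (hp u) (hp v) huv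
        (by rw [hcomp]; exact hfin)
      refine tendsto_of_tendsto_of_tendsto_of_le_of_le' tendsto_const_nhds (h.comp hM)
        (Eventually.of_forall fun _ => zero_le) ?_
      filter_upwards [hsmall η hη] with n hn
      refine measure_mono ?_
      rintro x ⟨-, hx⟩ z
      exact (hx z).trans_le (mul_le_mul_of_nonneg_right hn (Nat.cast_nonneg _))
    · simp [huv]
  have hconf : Tendsto (fun n : ℕ => ρ {x | ¬ AllConform G p n (M n) ((n : ℝ) ^ β * √(M n)) x})
      atTop (𝓝 0) := by
    have h1 : Tendsto (fun n : ℕ => ENNReal.ofReal (n * (2 * r ^ 2 * Real.exp (1 - (n : ℝ) ^ β)))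
        + ENNReal.ofReal (n * n * (2 * (r * r) ^ 2 * Real.exp (1 - (n : ℝ) ^ β)))) atTop (𝓝 0) := by
      rw [← add_zero (0 : ℝ≥0∞)]
      refine Tendsto.add ?_ ?_
      · have h := (tendsto_rpow_mul_exp_neg_rpow 1 hβ).const_mul (2 * (r : ℝ) ^ 2)
        rw [mul_zero] at h
        rw [← ENNReal.ofReal_zero]
        refine ENNReal.tendsto_ofReal (h.congr fun n => ?_)
        rw [Real.rpow_one]; ring
      · have h := (tendsto_rpow_mul_exp_neg_rpow 2 hβ).const_mul (2 * ((r : ℝ) * r) ^ 2)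
        rw [mul_zero] at h
        rw [← ENNReal.ofReal_zero]
        refine ENNReal.tendsto_ofReal (h.congr fun n => ?_)
        rw [Real.rpow_two]; ring
    refine tendsto_of_tendsto_of_tendsto_of_le_of_le' tendsto_const_nhds h1
      (Eventually.of_forall fun _ => zero_le) ?_
    filter_upwards [hM.eventually_ge_atTop 1] with n hn
    exact hρ.measure_not_allConform_le hp n hn _
  have hsum := (hconf.add (tendsto_finsetSum hfin.toFinset fun v _ => hvis v)).add
    (tendsto_finsetSum hfin.toFinset fun u hu =>
      tendsto_finsetSum hfin.toFinset fun v _ => hdef u hu v)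
  simp only [Finset.sum_const_zero, add_zero] at hsum
  refine tendsto_of_tendsto_of_tendsto_of_le_of_le tendsto_const_nhds hsum (fun _ => zero_le)
    fun n => ?_
  refine le_trans (measure_mono (t := ({x | ¬ AllConform G p n (M n) ((n : ℝ) ^ β * √(M n)) x} ∪
    ⋃ v ∈ hfin.toFinset, {x | ∃ i, visits (x v) (M n) i ≤ (n : ℝ) ^ (-β) * M n}) ∪
    ⋃ u ∈ hfin.toFinset, ⋃ v ∈ hfin.toFinset, {x | G.Adj u v ∧
      ∀ z, pairDefect (p u) (p v) (M n) (pairTrace x u v) z < (n : ℝ) ^ (-β) * M n}) ?_) ?_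
  · intro x hx
    by_contra hcon
    simp only [Set.mem_union, Set.mem_iUnion, Set.mem_ofPred_eq, not_or, not_not, not_exists,
      not_and, not_forall, not_lt, exists_prop, not_le, Set.Finite.mem_toFinset] at hcon
    obtain ⟨⟨hc, hv⟩, hd⟩ := hcon
    have hmem : ∀ {z v : Fin n}, z.val = 0 → (firstUsers G n).Reachable z v →
        (v : ℕ) ∈ (G.connectedComponentMk 0).supp := fun {z v} hz h => by
      have := reachable_of_firstUsers h
      rw [hz] at this
      exact SimpleGraph.ConnectedComponent.sound this.symm
    refine hx ⟨hc, fun z hz => ⟨fun v hzv => ⟨hc.1 v, fun i => hv v (hmem hz hzv) i⟩,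
      fun u v hzu huv => ?_⟩⟩
    exact hd u (hmem hz hzu) v (hmem hz (hzu.trans huv.reachable)) huv
  · refine (measure_union_le _ _).trans (add_le_add ((measure_union_le _ _).trans
      (add_le_add le_rfl (measure_biUnion_finset_le _ _))) ?_)
    exact (measure_biUnion_finset_le _ _).trans
      (Finset.sum_le_sum fun u _ => measure_biUnion_finset_le _ _)

/-- Without collisions, traces that pass for the group of the user `0` give away that user. -/
theorem Passes.eq_of_notMem_collisions {n M : ℕ} {l b : ℝ} {x : Traces r}
    (hp : ∀ u, p u ∈ paramRegion E o) (hx : AllConform G p n M l x) (hl : 0 ≤ l) (hb : 0 < b)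
    (hlb : (r : ℝ) * r * l + 1 + 2 * (2 * l / b) * M < b)
    (hn : ∀ w, G.Reachable 0 w → w < n) (hcol : p ∉ collisions G n (2 * l / b))
    {z : Fin n} (hz : z.val = 0) {τ : Equiv.Perm (Fin n)}
    (hP : Passes (firstUsers G n) z (fun u => p u) M l b fun v => x (τ v)) : τ z = z := by
  by_contra hne
  have hτ0 : (τ z : ℕ) ≠ 0 := fun h => hne (Fin.ext (h.trans hz.symm))
  have hdist : ∀ v, (firstUsers G n).Reachable z v → dist (p (τ v)) (p v) ≤ 2 * l / b :=
    fun v hv => by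
      rw [dist_pi_le_iff (by positivity)]
      intro e
      have h := hP.param_close hx hb hv e.1.1 e.1.2
      rw [userMatrix_apply, userMatrix_apply, transitionMatrix_freeEdge,
        transitionMatrix_freeEdge] at h
      exact h
  have hre : ∀ v : Fin n, G.Reachable 0 v → (firstUsers G n).Reachable z v := fun v hv =>
    firstUsers_reachable (by rw [hz]; exact hn) (by rw [hz]; exact hv)
  refine hcol ?_
  -- If user `0` is sent into its own group, two members nearly agree; otherwise the whole image
  -- lies in one other group.
  by_cases h0 : G.Reachable 0 (τ z)
  · refine Or.inl (Set.mem_iUnion₂.2 ⟨τ z, ?_, Set.mem_iUnion.2 ⟨hτ0, ?_⟩⟩)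
    · exact SimpleGraph.ConnectedComponent.sound h0.symm
    · have := hdist z (SimpleGraph.Reachable.refl _)
      rwa [hz] at this
  · have hmem : ∀ v : (G.connectedComponentMk 0).supp, G.Reachable 0 v := fun v =>
      (SimpleGraph.ConnectedComponent.exact v.2).symm
    refine Or.inr (Set.mem_iUnion₂.2 ⟨τ z, Finset.mem_range.2 (τ z).2, Set.mem_iUnion₂.2
      ⟨fun v => τ ⟨v, hn v (hmem v)⟩, ⟨fun v w hvw => ?_, h0, fun v => ⟨(τ _).2, ?_⟩⟩, fun v => ?_⟩⟩)
    · have := τ.injective (Fin.ext hvw)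
      exact Subtype.ext (congrArg Fin.val this)
    · exact hP.reachable hp hx hb hlb (hre ⟨v, hn v (hmem v)⟩ (hmem v))
    · exact hdist ⟨v, hn v (hmem v)⟩ (hre ⟨v, hn v (hmem v)⟩ (hmem v))

end Convergence

/-! ### Convergence of the error probability -/

section Error

variable {r : ℕ} {E : Finset (Fin r × Fin r)} {o : Fin r → Fin r} {f : Param E o → ℝ≥0∞}

/-- Collisions at the precision of the estimator are improbable. -/
theorem tendsto_populationLaw_collisions (hf : IsParamDensity f) {G : SimpleGraph ℕ}
    (hG : HasSmallGroups G) {s : ℕ} (hs0 : 0 < s)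
    (hs : (G.connectedComponentMk 0).supp.ncard = s) {d : ℕ} (hd0 : 0 < d)
    (hd : Fintype.card (FreeEdge E o) = d) {α : ℝ} (hα : 0 < α) {e : ℕ → ℝ} (he0 : ∀ n, 0 ≤ e n)
    {K : ℝ}
    (he : ∀ᶠ n : ℕ in atTop, e n ≤ K * (n : ℝ) ^ (-(1 / (s * d) + α / 4))) :
    Tendsto (fun n => populationLaw f (collisions G n (e n))) atTop (𝓝 0) := by
  obtain ⟨δ, hδ⟩ := hf.bounded
  have hs' : (0 : ℝ) < s := Nat.cast_pos.2 hs0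
  have hd' : (0 : ℝ) < d := Nat.cast_pos.2 hd0
  set γ : ℝ := 1 / (s * d) + α / 4 with hγ
  have hγ0 : 0 < γ := by positivity
  -- Since s·d·γ = 1 + s·d·α/4, group sizes of order n^(dα/8) give n · n^(sdα/8) · n^(-sdγ) =
  -- n^(-sdα/8).
  obtain ⟨B, hB⟩ := hG.2 (d * α / 8) (by positivity)
  have h1 : Tendsto (fun n : ℕ => s * (δ * (2 * (K * (n : ℝ) ^ (-γ))) ^ d)) atTop (𝓝 0) := by
    have h := ((((((tendsto_natCast_rpow_neg (neg_neg_of_pos hγ0)).const_mul K).const_mul 2).pow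
      d).const_mul (δ : ℝ)).const_mul (s : ℝ))
    simpa [hd0.ne'] using h
  have h2 : Tendsto (fun n : ℕ => n * ((B * (n : ℝ) ^ (d * α / 8)) ^ s *
      (δ * (2 * (K * (n : ℝ) ^ (-γ))) ^ d) ^ s)) atTop (𝓝 0) := by
    have hneg : -(s * d * α / 8) < 0 := by
      have : 0 < s * d * α / 8 := by positivity
      linarith
    have h := (tendsto_natCast_rpow_neg hneg).const_mul (B ^ s * (δ * (2 * K) ^ d) ^ s)
    rw [mul_zero] at h
    refine h.congr' ?_
    filter_upwards [eventually_gt_atTop 0] with n hn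
    have hn0 : (0 : ℝ) < n := Nat.cast_pos.2 hn
    have hexp : (n : ℝ) ^ (-(s * d * α / 8)) = n * ((n : ℝ) ^ (d * α / 8)) ^ s * (((n : ℝ) ^ (-γ)) ^ d) ^ s := by
      rw [← Real.rpow_natCast _ s, ← Real.rpow_natCast _ d, ← Real.rpow_natCast _ s,
        ← Real.rpow_mul hn0.le, ← Real.rpow_mul hn0.le, ← Real.rpow_mul hn0.le]
      nth_rewrite 2 [← Real.rpow_one (n : ℝ)]
      rw [← Real.rpow_add hn0, ← Real.rpow_add hn0]
      congr 1
      rw [hγ]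
      field_simp
      ring
    rw [hexp]
    simp only [mul_pow]
    ring
  have h3 := (ENNReal.tendsto_ofReal h1).add (ENNReal.tendsto_ofReal h2)
  rw [ENNReal.ofReal_zero, add_zero] at h3
  refine tendsto_of_tendsto_of_tendsto_of_le_of_le' tendsto_const_nhds h3
    (Eventually.of_forall fun _ => zero_le) ?_
  filter_upwards [he] with n hn
  refine (populationLaw_collisions_le hf hδ hG.1 (he0 n) (hB n) hs).trans ?_
  have hBn : 0 ≤ B * (n : ℝ) ^ (d * α / 8) :=
    (Nat.cast_nonneg _).trans (hB n (G.connectedComponentMk 0))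
  have h4 := he0 n
  rw [hd]
  have h5 : δ * (2 * e n) ^ d ≤ δ * (2 * (K * (n : ℝ) ^ (-γ))) ^ d := by gcongr
  have h6 : 0 ≤ δ * (2 * e n) ^ d := by positivity
  exact add_le_add (ENNReal.ofReal_le_ofReal (by gcongr)) (ENNReal.ofReal_le_ofReal (by gcongr))

/-- The parameters and data for which the estimator errs for some assignment of pseudonyms. -/
def errorSet {m : ℕ → ℕ} (A : Estimator E o m) (G : SimpleGraph ℕ) (n k : ℕ) :
    Set ((ℕ → Param E o) × Traces r) :=
  ⋃ π : Equiv.Perm (Fin n),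
    {q | A n (firstUsers G n) (fun u => q.1 u) (anonymize (m n) π q.2) k ≠ q.2 0 k}

theorem measurableSet_errorSet {m : ℕ → ℕ} {A : Estimator E o m} (hA : A.IsMeasurable)
    (G : SimpleGraph ℕ) (n k : ℕ) : MeasurableSet (errorSet A G n k) := by
  refine MeasurableSet.iUnion fun π => (measurableSet_eq_fun ?_ ?_).compl
  · refine (hA n (firstUsers G n) k).comp (Measurable.prodMk ?_ ?_)
    · fun_prop
    · fun_prop
  · fun_prop

/-- The permutation may depend on parameters and data in any way, since `errorSet` contains the
errors for every permutation. -/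
theorem measure_errorEvent_le {m : ℕ → ℕ} {A : Estimator E o m} (hA : A.IsMeasurable)
    [IsProbabilityMeasure (populationLaw f)]
    {Q : Kernel (ℕ → Param E o) (Traces r)} [IsMarkovKernel Q] (G : SimpleGraph ℕ)
    {Ω : Type*} [MeasurableSpace Ω] {μ : Measure Ω} {P : Ω → ℕ → Param E o} {X : Ω → Traces r}
    (perm : (n : ℕ) → Ω → Equiv.Perm (Fin n)) (hP : Measurable P) (hX : Measurable X)
    (hlaw : μ.map (fun ω => (P ω, X ω)) = (populationLaw f) ⊗ₘ Q) (n k : ℕ) :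
    μ (errorEvent A G P X perm n k)
      ≤ ∫⁻ p, Q p (Prod.mk p ⁻¹' errorSet A G n k) ∂(populationLaw f) := by
  rw [← Measure.compProd_apply (measurableSet_errorSet hA G n k), ← hlaw]
  refine (measure_mono fun ω hω => ?_).trans (Measure.le_map_apply (hP.prodMk hX).aemeasurable _)
  exact Set.mem_iUnion.2 ⟨perm n ω, hω⟩

/-- The exceptional sets are small in measure only; a point may lie in infinitely many of them. So
they are cut out by measure, and dominated convergence applies to the rest. -/
theorem tendsto_lintegral_of_tendsto_off {α : Type*} [MeasurableSpace α] {μ : Measure α}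
    [IsProbabilityMeasure μ] {h : ℕ → α → ℝ≥0∞} (hm : ∀ n, Measurable (h n))
    (h1 : ∀ n a, h n a ≤ 1) {D : ℕ → Set α} (hD : Tendsto (fun n => μ (D n)) atTop (𝓝 0))
    {g : ℕ → α → ℝ≥0∞} (hg : ∀ᵐ a ∂μ, Tendsto (fun n => g n a) atTop (𝓝 0))
    (hgh : ∀ᵐ a ∂μ, ∀ᶠ n in atTop, a ∉ D n → h n a ≤ g n a) :
    Tendsto (fun n => ∫⁻ a, h n a ∂μ) atTop (𝓝 0) := by
  -- Measurable hulls, as the sets `D n` are not assumed measurable.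
  let D' : ℕ → Set α := fun n => toMeasurable μ (D n)
  have hD' : ∀ n, MeasurableSet (D' n) := fun n => measurableSet_toMeasurable _ _
  have hlim : Tendsto (fun n => ∫⁻ a, (D' n)ᶜ.indicator (h n) a ∂μ) atTop (𝓝 0) := by
    have hdom := tendsto_lintegral_of_dominated_convergence (μ := μ)
      (F := fun n => (D' n)ᶜ.indicator (h n)) (f := fun _ => 0) (fun _ => 1)
      (fun n => (hm n).indicator (hD' n).compl)
      (fun n => Eventually.of_forall fun a => (Set.indicator_le_self' (fun _ _ => zero_le) a).trans (h1 n a))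
      (by simp) ?_
    · simpa using hdom
    filter_upwards [hg, hgh] with a ha hah
    refine tendsto_of_tendsto_of_tendsto_of_le_of_le' tendsto_const_nhds ha
      (Eventually.of_forall fun _ => zero_le) ?_
    filter_upwards [hah] with n hn
    by_cases haD : a ∈ D' n
    · simp [haD]
    · rw [Set.indicator_of_mem haD]
      exact hn fun h => haD (subset_toMeasurable _ _ h)
  have hsum := hlim.add hD
  rw [add_zero] at hsum
  refine tendsto_of_tendsto_of_tendsto_of_le_of_le tendsto_const_nhds hsum (fun _ => zero_le)
    fun n => ?_
  rw [← lintegral_add_compl _ (hD' n), lintegral_indicator (hD' n).compl, add_comm]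
  refine add_le_add le_rfl ?_
  calc ∫⁻ a in D' n, h n a ∂μ ≤ ∫⁻ a in D' n, 1 ∂μ := lintegral_mono fun a => h1 n a
    _ = μ (D n) := by rw [setLIntegral_one, measure_toMeasurable]

end Error

theorem theorem3 (r : ℕ) (E : Finset (Fin r × Fin r))
    (h_irr : IrreducibleOn (fun i l => (i, l) ∈ E) Set.univ)
    (h_aper : AperiodicOn (fun i l => (i, l) ∈ E) Set.univ)
    (hr : r < E.card)
    (o : Fin r → Fin r) (ho : ∀ i, (i, o i) ∈ E)
    (s : ℕ) (hs : 0 < s) (c α : ℝ) (hc : 0 < c) (hα : 0 < α)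
    (m : ℕ → ℕ)
    (hm : ∀ n : ℕ,
      |(m n : ℝ) - c * (n : ℝ) ^ (2 / ((s : ℝ) * ((E.card : ℝ) - (r : ℝ))) + α)| < 1) :
    ∃ A : Estimator E o m, A.IsMeasurable ∧
      ∀ (f : Param E o → ℝ≥0∞), IsParamDensity f →
      ∀ (G : SimpleGraph ℕ), HasSmallGroups G →
        (G.connectedComponentMk 0).supp.ncard = s →
      ∀ (Q : Kernel (ℕ → Param E o) (Traces r)), IsMarkovKernel Q →
        (∀ᵐ p ∂(populationLaw f), IsDataLaw G p (Q p)) →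
      ∀ (Ω : Type*) [MeasurableSpace Ω] (μ : Measure Ω) [IsProbabilityMeasure μ]
        (P : Ω → ℕ → Param E o) (X : Ω → Traces r)
        (perm : (n : ℕ) → Ω → Equiv.Perm (Fin n)),
        Measurable P → Measurable X → (∀ n π, MeasurableSet {ω | perm n ω = π}) →
        μ.map (fun ω => (P ω, X ω)) = (populationLaw f) ⊗ₘ Q →
        ∀ k : ℕ, Tendsto (fun n => μ (errorEvent A G P X perm n k)) atTop (𝓝 0) := by
  obtain ⟨d, hd⟩ : ∃ d, Fintype.card (FreeEdge E o) = d := ⟨_, rfl⟩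
  have hdE : d + r = E.card := by rw [← hd]; exact card_freeEdge ho
  have hd0 : 0 < d := by omega
  have hds : (E.card : ℝ) - r = d := by rw [← hdE]; push_cast; ring
  have hs' : (0 : ℝ) < s := Nat.cast_pos.2 hs
  have hd' : (0 : ℝ) < d := Nat.cast_pos.2 hd0
  rw [hds] at hm
  set κ : ℝ := 2 / (s * d) + α with hκdef
  have hκ : 0 < κ := by positivity
  have hr0 : 0 < r := Nat.pos_of_ne_zero fun h => by
    subst h
    simp [Finset.eq_empty_of_isEmpty] at hr
  let i₀ : Fin r := ⟨0, hr0⟩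
  -- With β = α/8 the precision exponent 2β - κ/2 is -(1/(sd) + α/4), which leaves a surplus α/4 for
  -- the collision bound.
  have hβ : 0 < α / 8 := by positivity
  have hβκ : 3 * (α / 8) < κ / 2 := by
    have : 0 < 2 / ((s : ℝ) * d) := by positivity
    linarith
  refine ⟨groupEstimator i₀ m (α / 8), groupEstimator_isMeasurable i₀ m _, ?_⟩
  intro f hf G hG hGs Q hQ hdata Ω _ μ _ P X perm hP hX _ hlaw k
  have := hf.isProbabilityMeasure_populationLaw
  have hA := groupEstimator_isMeasurable (E := E) (o := o) i₀ m (α / 8)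
  have hM := tendsto_sampleSize hc hκ hm
  let l : ℕ → ℝ := fun n => (n : ℝ) ^ (α / 8) * √(m n - 1 : ℕ)
  let b : ℕ → ℝ := fun n => (n : ℝ) ^ (-(α / 8)) * (m n - 1 : ℕ)
  have hl : ∀ n, 0 ≤ l n := fun n => by positivity
  have hb : ∀ n, 0 ≤ b n := fun n => by positivity
  have hcol : Tendsto (fun n => populationLaw f (collisions G n (2 * l n / b n))) atTop (𝓝 0) := by
    refine tendsto_populationLaw_collisions hf hG hs hGs hd0 hd hα
      (fun n => div_nonneg (mul_nonneg zero_le_two (hl n)) (hb n))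
      (K := 2 / √(c / 2)) ?_
    filter_upwards [eventually_precision_le hc hκ hm (α / 8)] with n hn
    refine hn.trans_eq ?_
    congr 2
    rw [hκdef]
    field_simp
    ring
  refine tendsto_of_tendsto_of_tendsto_of_le_of_le tendsto_const_nhds ?_ (fun _ => zero_le)
    fun n => measure_errorEvent_le hA G perm hP hX hlaw n k
  refine tendsto_lintegral_of_tendsto_off
    (fun n => Kernel.measurable_kernel_prodMk_left (measurableSet_errorSet hA G n k))
    (fun n p => prob_le_one) hcol
    (g := fun n p => Q p {x | ¬ (AllConform G p n (m n - 1) (l n) x ∧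
      ∀ z : Fin n, z.val = 0 → Passes (firstUsers G n) z (fun u => p u) (m n - 1) (l n) (b n)
        fun v => x v)}) ?_ ?_
  · filter_upwards [hdata, ae_mem_paramRegion hf] with p hp hreg
    exact hp.tendsto_measure_not_passes h_irr h_aper ho i₀ hreg (hG.1 _) hM hβ
  · filter_upwards [ae_mem_paramRegion hf] with p hreg
    -- `N` bounds the labels in the group of user `0`; for n > N the system contains the whole
    -- group.
    obtain ⟨N, hN⟩ := (hG.1 (G.connectedComponentMk 0)).bddAbove
    filter_upwards [eventually_threshold_lt hc hκ hm hβ hβκ ((r : ℝ) * r) (by positivity),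
      hM.eventually_gt_atTop k, eventually_gt_atTop N]
      with n hlb hk hn hpn
    refine measure_mono ?_
    intro x hx hgood
    obtain ⟨π, hπ⟩ := Set.mem_iUnion.1 hx
    have hn0 : 0 < n := by omega
    have hb0 : 0 < b n := by
      have : (0 : ℝ) < (m n - 1 : ℕ) := Nat.cast_pos.2 (by omega)
      have : (0 : ℝ) < n := Nat.cast_pos.2 hn0
      positivity
    have hin : ∀ w, G.Reachable 0 w → w < n := fun w hw =>
      (hN (SimpleGraph.ConnectedComponent.sound hw.symm)).trans_lt hn
    refine hπ (groupEstimator_eq (z := ⟨0, hn0⟩) rfl (by omega) (hgood.2 _ rfl) (fun τ hτ => ?_) π)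
    exact hτ.eq_of_notMem_collisions hreg hgood.1 (hl n) hb0 hlb hin hpn rfl
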